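/- Let $d \ge 1$ be an integer. For an integrable $u \colon \mathbb{R}^d \to \mathbb{R}$ let \[ \|Du\|(\mathbb{R}^d) = \sup\Big\{ \int_{\mathbb{R}^d} u \operatorname{div} v : v \in C^1_c(\mathbb{R}^d;\mathbb{R}^d),\ |v| \le 1 \Big\}. \] Let $BV([0,1]^d)$ be the space of (classes of) integrable functions $u$ on $\mathbb{R}^d$ with $\|Du\|(\mathbb{R}^d) < \infty$ and $u = 0$ a.e. outside $[0,1]^d$, normed by $\|u\|_{BV} = \|u\|_1 + \|Du\|(\mathbb{R}^d)$. Let $T \colon L^d([0,1]^d) \to BV([0,1]^d)^*$ be the continuous linear operator given by $T_f(u) = \int_{[0,1]^d} f u$, and let $SCH([0,1]^d)$, the space of strong charge functionals, be the closure of the range of $T$ in $BV([0,1]^d)^*$, with the norm of $BV([0,1]^d)^*$. A dyadic cube of generation $n \ge 0$ is a set $\prod_{i=1}^d [2^{-n}c_i, 2^{-n}(c_i+1)]$ with integers $0 \le c_i \le 2^n-1$. For each $n \ge 0$ let $K_{n,k}$, $0 \le k \le 2^{nd}-1$, be an enumeration without repetition of the dyadic cubes of generation $n$, such that for all $n$ and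 $k$ the cubes $K_{n+1,2^dk}, \dots, K_{n+1,2^dk+2^d-1}$ are the $2^d$ dyadic cubes of generation $n+1$ contained in $K_{n,k}$. Let $A_1 = \begin{pmatrix} 1 & 1 \\ 1 & -1 \end{pmatrix}$ and $A_{m+1} = \begin{pmatrix} A_m & A_m \\ A_m & -A_m \end{pmatrix}$, with rows and columns of $A_d$ numbered from $0$ to $2^d-1$. The Haar functions are $g_{-1} = \mathbf{1}_{[0,1]^d}$ and \[ g_{n,k,r} = 2^{nd/2} \sum_{\ell=0}^{2^d-1} (A_d)_{r,\ell}\, \mathbf{1}_{K_{n+1,2^dk+\ell}}, \qquad n \ge 0,\ 0 \le k \le 2^{nd}-1,\ 1 \le r \le 2^d-1; \] they belong to $BV([0,1]^d)$ and to $L^d([0,1]^d)$. Theorem. The sequence $T_{g_{-1}}, T_{g_{0,0,1}}, T_{g_{0,0,2}}, \dots$ (the indices $(n,k,r)$ being ordered lexicographically) is a Schauder basis of $SCH([0,1]^d)$: for each $\alpha \in SCH([0,1]^d)$ there is a unique sequence of real coefficients for which the corresponding series converges to $\alpha$ in norm. The decomposition of $\alpha$ is \[ \alpha = \alpha(g_{-1})\,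 T_{g_{-1}} + \alpha(g_{0,0,1})\, T_{g_{0,0,1}} + \alpha(g_{0,0,2})\, T_{g_{0,0,2}} + \cdots, \] where the series, summed in this order, converges in the norm of $BV([0,1]^d)^*$; in particular the coefficient functionals are the evaluations $\alpha \mapsto \alpha(g)$ at the Haar functions $g$, and they are continuous. -/

import Mathlib

open MeasureTheory Filter Topology
open scoped ENNReal NNReal

namespace StrongCharge

noncomputable section

/-- Euclidean space `ℝᵈ`. -/
abbrev Space (d : ℕ) : Type := EuclideanSpace ℝ (Fin d)

/-- The closed unit cube `[0, 1]ᵈ`. -/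
def unitCube (d : ℕ) : Set (Space d) := {x | ∀ i, x i ∈ Set.Icc (0 : ℝ) 1}

/-- The divergence of a vector field. -/
def divergence {d : ℕ} (v : Space d → Space d) (x : Space d) : ℝ :=
  ∑ i, fderiv ℝ v x (EuclideanSpace.single i 1) i

/-- The vector fields `v ∈ C¹_c(ℝᵈ; ℝᵈ)` with `|v| ≤ 1`. -/
structure IsTestField {d : ℕ} (v : Space d → Space d) : Prop where
  contDiff : ContDiff ℝ 1 v
  hasCompactSupport : HasCompactSupport v
  norm_le_one : ∀ x, ‖v x‖ ≤ 1

/-- The variation `‖Du‖(ℝᵈ)` of an integrable function `u : ℝᵈ → ℝ`. -/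
def variation {d : ℕ} (u : Space d → ℝ) : ℝ≥0∞ :=
  ⨆ (v : Space d → Space d) (_ : IsTestField v), ENNReal.ofReal (∫ x, u x * divergence v x)

/-- `u` is a function of bounded variation on `ℝᵈ` that vanishes a.e. outside `[0, 1]ᵈ`. -/
structure MemBV {d : ℕ} (u : Space d → ℝ) : Prop where
  integrable : Integrable u
  variation_lt_top : variation u < ∞
  ae_eq_zero : ∀ᵐ x, x ∉ unitCube d → u x = 0

section basic

variable {d : ℕ} {u w : Space d → ℝ} {v : Space d → Space d}

theorem IsTestField.zero : IsTestField (fun _ : Space d => (0 : Space d)) :=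
  ⟨contDiff_const, HasCompactSupport.zero, by simp⟩

theorem IsTestField.neg (hv : IsTestField v) : IsTestField (fun x => -v x) :=
  ⟨hv.contDiff.neg, hv.hasCompactSupport.neg, by simpa using hv.norm_le_one⟩

theorem divergence_neg (x : Space d) : divergence (fun x => -v x) x = -divergence v x := by
  simp [divergence, fderiv_fun_neg]

theorem IsTestField.continuous_divergence (hv : IsTestField v) : Continuous (divergence v) := by
  have := hv.contDiff.continuous_fderiv one_ne_zero
  unfold divergence
  fun_prop

theorem IsTestField.hasCompactSupport_divergence (hv : IsTestField v) :
    HasCompactSupport (divergence v) := by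
  refine (hv.hasCompactSupport.fderiv ℝ).mono fun x hx => ?_
  contrapose! hx
  simp only [Function.mem_support, not_not] at hx ⊢
  simp [divergence, hx]

theorem IsTestField.exists_bound (hv : IsTestField v) : ∃ C, ∀ x, ‖divergence v x‖ ≤ C :=
  hv.hasCompactSupport_divergence.exists_bound_of_continuous hv.continuous_divergence

theorem IsTestField.integrable_mul (hv : IsTestField v) (hu : Integrable u) :
    Integrable (fun x => u x * divergence v x) := by
  obtain ⟨C, hC⟩ := hv.exists_bound
  exact hu.mul_bdd hv.continuous_divergence.aestronglyMeasurable (Eventually.of_forall hC)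

theorem IsTestField.ofReal_le (hv : IsTestField v) (u : Space d → ℝ) :
    ENNReal.ofReal (∫ x, u x * divergence v x) ≤ variation u :=
  le_iSup₂ (f := fun (v : Space d → Space d) (_ : IsTestField v) =>
    ENNReal.ofReal (∫ x, u x * divergence v x)) v hv

theorem IsTestField.abs_integral_le (hv : IsTestField v) (hu : variation u < ∞) :
    |∫ x, u x * divergence v x| ≤ (variation u).toReal := by
  have h1 := (ENNReal.ofReal_le_iff_le_toReal hu.ne).1 (hv.ofReal_le u)
  have h2 := (ENNReal.ofReal_le_iff_le_toReal hu.ne).1 (hv.neg.ofReal_le u)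
  simp only [divergence_neg, mul_neg, integral_neg] at h2
  exact _root_.abs_le.2 ⟨by linarith, h1⟩

theorem variation_congr (h : u =ᵐ[volume] w) : variation u = variation w := by
  have (v : Space d → Space d) : ∫ x, u x * divergence v x = ∫ x, w x * divergence v x :=
    integral_congr_ae (h.mono fun x hx => by simp only [hx])
  simp only [variation, this]

theorem variation_add_le (hu : Integrable u) (hw : Integrable w) :
    variation (fun x => u x + w x) ≤ variation u + variation w := by
  refine iSup₂_le fun v hv => ?_
  simp only [add_mul]
  rw [integral_add (hv.integrable_mul hu) (hv.integrable_mul hw)]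
  exact ENNReal.ofReal_add_le.trans (add_le_add (hv.ofReal_le u) (hv.ofReal_le w))

theorem variation_smul_le (c : ℝ) : variation (fun x => c * u x) ≤ ENNReal.ofReal |c| * variation u := by
  refine iSup₂_le fun v hv => ?_
  simp only [mul_assoc]
  rw [integral_const_mul]
  rcases le_total 0 c with hc | hc
  · rw [ENNReal.ofReal_mul hc, abs_of_nonneg hc]
    gcongr
    exact hv.ofReal_le u
  · rw [← neg_mul_neg, ENNReal.ofReal_mul (neg_nonneg.2 hc), abs_of_nonpos hc]
    gcongr
    simpa [divergence_neg, integral_neg] using hv.neg.ofReal_le u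

theorem variation_zero : variation (fun _ : Space d => (0 : ℝ)) = 0 := by
  simp [variation]

theorem MemBV.zero : MemBV (fun _ : Space d => (0 : ℝ)) :=
  ⟨integrable_zero _ _ _, by simp [variation_zero], by simp⟩

theorem MemBV.add (hu : MemBV u) (hw : MemBV w) : MemBV (fun x => u x + w x) :=
  ⟨hu.integrable.add hw.integrable,
    (variation_add_le hu.integrable hw.integrable).trans_lt
      (ENNReal.add_lt_top.2 ⟨hu.variation_lt_top, hw.variation_lt_top⟩), by
    filter_upwards [hu.ae_eq_zero, hw.ae_eq_zero] with x h1 h2 hx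
    simp [h1 hx, h2 hx]⟩

theorem MemBV.const_mul (hu : MemBV u) (c : ℝ) : MemBV (fun x => c * u x) :=
  ⟨hu.integrable.const_mul c,
    (variation_smul_le c).trans_lt (ENNReal.mul_lt_top ENNReal.ofReal_lt_top hu.variation_lt_top), by
    filter_upwards [hu.ae_eq_zero] with x h1 hx
    simp [h1 hx]⟩

theorem MemBV.congr (hu : MemBV u) (h : u =ᵐ[volume] w) : MemBV w :=
  ⟨hu.integrable.congr h, variation_congr h ▸ hu.variation_lt_top, by
    filter_upwards [hu.ae_eq_zero, h] with x h1 h2 hx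
    rw [← h2, h1 hx]⟩

theorem MemBV.sum {ι : Type*} (s : Finset ι) {f : ι → Space d → ℝ} (h : ∀ i ∈ s, MemBV (f i)) :
    MemBV (fun x => ∑ i ∈ s, f i x) := by
  classical
  induction s using Finset.induction_on with
  | empty => simpa using MemBV.zero
  | insert a s ha ih =>
    simp only [Finset.sum_insert ha]
    exact (h a (by simp)).add (ih fun i hi => h i (by simp [hi]))

end basic

/-- The subspace of `L¹(ℝᵈ)` underlying `BV([0, 1]ᵈ)`. -/
def bvSubmodule (d : ℕ) : Submodule ℝ (Lp ℝ 1 (volume : Measure (Space d))) where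
  carrier := {u | MemBV (u : Space d → ℝ)}
  add_mem' {u w} hu hw := (MemBV.add hu hw).congr (Lp.coeFn_add u w).symm
  zero_mem' := MemBV.zero.congr (Lp.coeFn_zero ℝ 1 volume).symm
  smul_mem' c u hu := (MemBV.const_mul hu c).congr (Lp.coeFn_smul c u).symm

/-- The space `BV([0, 1]ᵈ)`; its norm is defined below (it is not the norm of `L¹`). -/
def BV (d : ℕ) : Type := bvSubmodule d

namespace BV

variable {d : ℕ}

instance : AddCommGroup (BV d) := inferInstanceAs (AddCommGroup (bvSubmodule d))
instance : Module ℝ (BV d) := inferInstanceAs (Module ℝ (bvSubmodule d))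

/-- The inclusion of `BV([0, 1]ᵈ)` in `L¹(ℝᵈ)`. -/
def toL1 : BV d →ₗ[ℝ] Lp ℝ 1 (volume : Measure (Space d)) := (bvSubmodule d).subtype

instance : CoeFun (BV d) fun _ => Space d → ℝ := ⟨fun u => (toL1 u : Space d → ℝ)⟩

/-- The element of `BV([0, 1]ᵈ)` given by a function. -/
def mk (u : Space d → ℝ) (hu : MemBV u) : BV d :=
  ⟨(memLp_one_iff_integrable.2 hu.integrable).toLp u,
    hu.congr (memLp_one_iff_integrable.2 hu.integrable).coeFn_toLp.symm⟩

theorem coe_mk (u : Space d → ℝ) (hu : MemBV u) : (mk u hu : Space d → ℝ) =ᵐ[volume] u :=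
  (memLp_one_iff_integrable.2 hu.integrable).coeFn_toLp

theorem memBV (u : BV d) : MemBV (u : Space d → ℝ) := u.2

theorem toL1_injective : Function.Injective (toL1 (d := d)) := Subtype.val_injective

/-- The norm `‖u‖_BV = ‖u‖₁ + ‖Du‖(ℝᵈ)`. -/
instance : Norm (BV d) := ⟨fun u => (∫ x, |u x|) + (variation u).toReal⟩

theorem norm_def (u : BV d) : ‖u‖ = (∫ x, |u x|) + (variation u).toReal := rfl

theorem coe_add (u w : BV d) : (u + w : BV d) =ᵐ[volume] fun x => u x + w x := by
  rw [map_add]; exact Lp.coeFn_add _ _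

theorem coe_smul (c : ℝ) (u : BV d) : (c • u : BV d) =ᵐ[volume] fun x => c * u x := by
  rw [map_smul]; exact Lp.coeFn_smul _ _

theorem norm_smul_le' (c : ℝ) (u : BV d) : ‖c • u‖ ≤ |c| * ‖u‖ := by
  rw [norm_def, norm_def, mul_add]
  gcongr ?_ + ?_
  · rw [integral_congr_ae (g := fun x => |c| * |u x|)
      ((coe_smul c u).mono fun x hx => by simp only [hx, abs_mul]), integral_const_mul]
  · rw [variation_congr (coe_smul c u)]
    refine (ENNReal.toReal_mono (ENNReal.mul_ne_top ENNReal.ofReal_ne_top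
      u.memBV.variation_lt_top.ne) (variation_smul_le c)).trans ?_
    simp

theorem normCore : NormedSpace.Core ℝ (BV d) where
  norm_nonneg u := by rw [norm_def]; positivity
  norm_smul c u := by
    refine le_antisymm (norm_smul_le' c u) ?_
    rcases eq_or_ne c 0 with rfl | hc
    · simp [norm_def]
    · have := norm_smul_le' c⁻¹ (c • u)
      rw [smul_smul, inv_mul_cancel₀ hc, one_smul, abs_inv] at this
      rw [Real.norm_eq_abs]
      have h0 : 0 < |c| := abs_pos.2 hc
      calc |c| * ‖u‖ ≤ |c| * (|c|⁻¹ * ‖c • u‖) := by gcongr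
        _ = ‖c • u‖ := by field_simp
  norm_triangle u w := by
    have hu := u.memBV
    have hw := w.memBV
    simp only [norm_def]
    have h1 : (∫ x, |(u + w : BV d) x|) ≤ (∫ x, |u x|) + ∫ x, |w x| := by
      rw [← integral_add hu.integrable.abs hw.integrable.abs]
      refine integral_mono_ae (u + w).memBV.integrable.abs
        (hu.integrable.abs.add hw.integrable.abs) ?_
      filter_upwards [coe_add u w] with x hx
      rw [hx]
      exact abs_add_le (u x) (w x)
    have h2 : (variation (u + w : BV d)).toReal ≤ (variation u).toReal + (variation w).toReal := by
      rw [variation_congr (coe_add u w), ← ENNReal.toReal_add hu.variation_lt_top.ne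
        hw.variation_lt_top.ne]
      exact ENNReal.toReal_mono (ENNReal.add_ne_top.2
        ⟨hu.variation_lt_top.ne, hw.variation_lt_top.ne⟩)
        (variation_add_le hu.integrable hw.integrable)
    linarith
  norm_eq_zero_iff u := by
    constructor
    · intro h
      rw [norm_def] at h
      have h1 : (∫ x, |u x|) = 0 :=
        le_antisymm (by linarith [ENNReal.toReal_nonneg (a := variation u)]) (by positivity)
      rw [integral_eq_zero_iff_of_nonneg (fun x => abs_nonneg _) u.memBV.integrable.abs] at h1
      refine toL1_injective ?_
      rw [map_zero]
      refine Lp.ext ?_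
      filter_upwards [h1, Lp.coeFn_zero ℝ 1 (volume : Measure (Space d))] with x hx h0
      rw [h0]
      simpa using hx
    · rintro rfl
      have h0 : ((0 : BV d) : Space d → ℝ) =ᵐ[volume] fun _ => 0 := by
        rw [map_zero]; exact Lp.coeFn_zero _ _ _
      rw [norm_def, variation_congr h0, variation_zero,
        integral_congr_ae (g := fun _ => 0) (h0.mono fun x hx => by simp only [hx, abs_zero])]
      simp

instance : NormedAddCommGroup (BV d) := NormedAddCommGroup.ofCore normCore
instance : NormedSpace ℝ (BV d) := NormedSpace.ofCore normCore

theorem norm_eq (u : BV d) : ‖u‖ = (∫ x, |u x|) + (variation u).toReal := rfl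

end BV

section sobolev

theorem unitCube_eq (d : ℕ) : unitCube d = WithLp.ofLp ⁻¹' Set.Icc (0 : Fin d → ℝ) 1 := by
  ext x
  simp [unitCube, Set.mem_Icc, Pi.le_def, forall_and]

theorem isCompact_unitCube (d : ℕ) : IsCompact (unitCube d) := by
  rw [unitCube_eq]
  exact (PiLp.continuousLinearEquiv 2 ℝ (fun _ : Fin d => ℝ)).toHomeomorph.isCompact_preimage.2
    isCompact_Icc

variable {d : ℕ} {u w : Space d → ℝ}

theorem isTestField_single {ψ : Space d → ℝ} (i : Fin d) (h : ContDiff ℝ 1 ψ)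
    (hc : HasCompactSupport ψ) (h1 : ∀ x, |ψ x| ≤ 1) :
    IsTestField (fun x => ψ x • EuclideanSpace.single i (1 : ℝ)) :=
  ⟨h.smul contDiff_const, hc.smul_right, fun x => by simpa [norm_smul] using h1 x⟩

theorem divergence_single {ψ : Space d → ℝ} (i : Fin d) (h : ContDiff ℝ 1 ψ) (x : Space d) :
    divergence (fun x => ψ x • EuclideanSpace.single i (1 : ℝ)) x =
      fderiv ℝ ψ x (EuclideanSpace.single i 1) := by
  have hd : DifferentiableAt ℝ ψ x := h.differentiable one_ne_zero x
  simp only [divergence]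
  rw [fderiv_smul_const hd]
  simp only [ContinuousLinearMap.smulRight_apply, PiLp.smul_apply, smul_eq_mul]
  rw [Finset.sum_eq_single i]
  · simp
  · intro j _ hj
    simp [hj]
  · simp

theorem integral_abs_partial_le (hw : ContDiff ℝ 2 w) (hc : HasCompactSupport w)
    (hV : variation w < ∞) (i : Fin d) :
    ∫ x, |fderiv ℝ w x (EuclideanSpace.single i 1)| ≤ (variation w).toReal := by
  set e : Space d := EuclideanSpace.single i 1 with he
  set p : Space d → ℝ := fun x => fderiv ℝ w x e with hp
  have hp1 : ContDiff ℝ 1 p := (hw.fderiv_right (m := 1) (by norm_num)).clm_apply contDiff_const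
  have hpc : HasCompactSupport p := hc.fderiv_apply ℝ e
  set S := tsupport p with hS
  have hSm : MeasurableSet S := (isClosed_tsupport p).measurableSet
  have hSf : volume S < ∞ := hpc.isCompact.measure_lt_top
  have key (δ : ℝ) (hδ : 0 < δ) : ∫ x, |p x| ≤ (variation w).toReal + δ * (volume S).toReal := by
    have hpos (x : Space d) : 0 < p x ^ 2 + δ ^ 2 := by positivity
    set ψ : Space d → ℝ := fun x => -(p x / √(p x ^ 2 + δ ^ 2)) with hψ
    have hψ1 : ContDiff ℝ 1 ψ := by
      refine (hp1.div (((hp1.pow 2).add contDiff_const).sqrt fun x => (hpos x).ne') fun x => ?_).neg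
      exact (Real.sqrt_pos.2 (hpos x)).ne'
    have hψc : HasCompactSupport ψ := by
      refine hpc.mono fun x hx => ?_
      contrapose! hx
      simp only [Function.mem_support, not_not] at hx ⊢
      simp [hψ, hx]
    have hψb (x : Space d) : |ψ x| ≤ 1 := by
      rw [hψ, abs_neg, abs_div, abs_of_pos (Real.sqrt_pos.2 (hpos x)),
        div_le_one (Real.sqrt_pos.2 (hpos x))]
      exact Real.abs_le_sqrt (by nlinarith)
    have hT := isTestField_single i hψ1 hψc hψb
    have h1 := (le_abs_self _).trans (hT.abs_integral_le hV)
    simp only [divergence_single i hψ1] at h1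
    have hwi : Integrable w := hw.continuous.integrable_of_hasCompactSupport hc
    have hcont : Continuous fun x => fderiv ℝ ψ x e := by
      have := hψ1.continuous_fderiv one_ne_zero
      fun_prop
    rw [integral_mul_fderiv_eq_neg_fderiv_mul_of_integrable] at h1
    rotate_left
    · exact (hp1.continuous.mul hψ1.continuous).integrable_of_hasCompactSupport hpc.mul_right
    · exact (hw.continuous.mul hcont).integrable_of_hasCompactSupport hc.mul_right
    · exact (hw.continuous.mul hψ1.continuous).integrable_of_hasCompactSupport hc.mul_right
    · exact fun x _ => hw.differentiable two_ne_zero x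
    · exact fun x _ => hψ1.differentiable one_ne_zero x
    have hI : Integrable (fun x => p x * ψ x) :=
      (hp1.continuous.mul hψ1.continuous).integrable_of_hasCompactSupport hpc.mul_right
    have hJ : Integrable (S.indicator fun _ : Space d => δ) :=
      (integrable_indicator_iff hSm).2 (integrableOn_const hSf.ne)
    have h2 : ∫ x, |p x| ≤ ∫ x, (-(p x * ψ x) + S.indicator (fun _ => δ) x) := by
      refine integral_mono (hp1.continuous.integrable_of_hasCompactSupport hpc).abs
        (hI.neg.add hJ) fun x => ?_
      by_cases hx : x ∈ S
      · simp only [Set.indicator_of_mem hx, hψ]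
        set s := √(p x ^ 2 + δ ^ 2) with hs
        have hs0 : 0 < s := Real.sqrt_pos.2 (hpos x)
        have hs2 : s ^ 2 = p x ^ 2 + δ ^ 2 := Real.sq_sqrt (hpos x).le
        have hsp : |p x| ≤ s := Real.abs_le_sqrt (by nlinarith)
        have hsd : δ ≤ s := Real.le_sqrt_of_sq_le (by nlinarith)
        have : -(p x * -(p x / s)) = s - δ * (δ / s) := by
          field_simp
          nlinarith
        rw [this]
        have : δ * (δ / s) ≤ δ * 1 := by
          gcongr
          exact (div_le_one hs0).2 hsd
        linarith
      · simp [image_eq_zero_of_notMem_tsupport hx, Set.indicator_of_notMem hx]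
    rw [integral_add (f := fun x => -(p x * ψ x)) hI.neg hJ, integral_neg, integral_indicator hSm,
      setIntegral_const] at h2
    simp only [smul_eq_mul, Measure.real] at h2
    linarith
  refine le_of_forall_pos_le_add fun ε hε => ?_
  have hv0 : 0 ≤ (volume S).toReal := ENNReal.toReal_nonneg
  refine (key (ε / ((volume S).toReal + 1)) (by positivity)).trans ?_
  gcongr
  rw [div_mul_eq_mul_div, div_le_iff₀ (by positivity)]
  nlinarith

theorem eLpNorm_fderiv_le (hw : ContDiff ℝ 2 w) (hc : HasCompactSupport w)
    (hV : variation w < ∞) : eLpNorm (fderiv ℝ w) 1 volume ≤ d * variation w := by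
  have hcont : Continuous (fderiv ℝ w) := hw.continuous_fderiv two_ne_zero
  rw [eLpNorm_one_eq_lintegral_enorm]
  calc ∫⁻ x, ‖fderiv ℝ w x‖ₑ
      ≤ ∫⁻ x, ∑ i : Fin d, ‖fderiv ℝ w x (EuclideanSpace.single i 1)‖ₑ := by
        refine lintegral_mono fun x => ?_
        have : ‖fderiv ℝ w x‖ ≤ ∑ i : Fin d, ‖fderiv ℝ w x (EuclideanSpace.single i 1)‖ := by
          refine ContinuousLinearMap.opNorm_le_bound _ (by positivity) fun y => ?_
          have hy : y = ∑ i, y i • EuclideanSpace.single i (1 : ℝ) := by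
            ext j
            simp [Finset.sum_apply, Pi.single_apply]
          conv_lhs => rw [hy, map_sum]
          rw [Finset.sum_mul]
          refine (norm_sum_le _ _).trans (Finset.sum_le_sum fun i _ => ?_)
          rw [map_smul, norm_smul, mul_comm]
          gcongr
          exact PiLp.norm_apply_le y i
        rw [← ofReal_norm]
        refine (ENNReal.ofReal_le_ofReal this).trans ?_
        rw [ENNReal.ofReal_sum_of_nonneg fun i _ => norm_nonneg _]
        simp only [ofReal_norm, le_refl]
    _ = ∑ i : Fin d, ∫⁻ x, ‖fderiv ℝ w x (EuclideanSpace.single i 1)‖ₑ := by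
        rw [lintegral_finsetSum]
        intro i _
        exact (by fun_prop : Continuous _).measurable
    _ ≤ ∑ _i : Fin d, variation w := by
        refine Finset.sum_le_sum fun i _ => ?_
        have hi : Integrable fun x => fderiv ℝ w x (EuclideanSpace.single i 1) :=
          (by fun_prop : Continuous fun x => fderiv ℝ w x (EuclideanSpace.single i 1)
            ).integrable_of_hasCompactSupport (hc.fderiv_apply ℝ _)
        rw [← ofReal_integral_norm_eq_lintegral_enorm hi]
        exact ENNReal.ofReal_le_of_le_toReal (integral_abs_partial_le hw hc hV i)
    _ = d * variation w := by simp

theorem IsTestField.comp_add {v : Space d → Space d} (hv : IsTestField v) (t : Space d) :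
    IsTestField (fun x => v (x + t)) :=
  ⟨hv.contDiff.comp (contDiff_id.add contDiff_const),
    hv.hasCompactSupport.comp_homeomorph (Homeomorph.addRight t), fun _ => hv.norm_le_one _⟩

theorem divergence_comp_add {v : Space d → Space d} (t x : Space d) :
    divergence (fun x => v (x + t)) x = divergence v (x + t) := by
  simp [divergence, fderiv_comp_add_right]

theorem variation_convolution_le (φ : ContDiffBump (0 : Space d)) (hu : Integrable u)
    (hV : variation u < ∞) :
    variation (convolution (φ.normed volume) u (ContinuousLinearMap.lsmul ℝ ℝ) volume) ≤
      variation u := by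
  refine iSup₂_le fun v hv => ENNReal.ofReal_le_of_le_toReal ?_
  set ρ : Space d → ℝ := φ.normed volume with hρ
  have hρi : Integrable ρ := φ.integrable_normed
  obtain ⟨C, hC⟩ := hv.exists_bound
  have hint : Integrable (Function.uncurry fun x t : Space d => ρ t * u (x - t) * divergence v x)
      (volume.prod volume) := by
    have h1 := hρi.convolution_integrand (ContinuousLinearMap.lsmul ℝ ℝ) hu
    exact h1.mul_bdd (c := C)
      (hv.continuous_divergence.comp continuous_fst).aestronglyMeasurable
      (Eventually.of_forall fun p => hC p.1)
  have hinner (t : Space d) : ∫ x, ρ t * u (x - t) * divergence v x =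
      ρ t * ∫ x, u x * divergence (fun y => v (y + t)) x := by
    simp only [mul_assoc, divergence_comp_add]
    rw [integral_const_mul, ← integral_sub_right_eq_self (fun x => u x * divergence v (x + t)) t]
    simp
  calc ∫ x, convolution ρ u (ContinuousLinearMap.lsmul ℝ ℝ) volume x * divergence v x
      = ∫ x, ∫ t, ρ t * u (x - t) * divergence v x := by
        refine integral_congr_ae (Eventually.of_forall fun x => ?_)
        simp only [convolution, ContinuousLinearMap.lsmul_apply, smul_eq_mul]
        rw [integral_mul_const]
    _ = ∫ t, ∫ x, ρ t * u (x - t) * divergence v x := integral_integral_swap hint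
    _ ≤ ∫ t, ρ t * (variation u).toReal := by
        refine integral_mono hint.integral_prod_right (hρi.mul_const _) fun t => ?_
        change ∫ x, ρ t * u (x - t) * divergence v x ≤ _
        rw [hinner]
        exact mul_le_mul_of_nonneg_left ((le_abs_self _).trans ((hv.comp_add t).abs_integral_le hV))
          (φ.nonneg_normed t)
    _ = (variation u).toReal := by
        rw [integral_mul_const, hρ, φ.integral_normed, one_mul]

theorem enorm_le_eLpNorm_fderiv {w : Space 1 → ℝ} (hw : ContDiff ℝ 1 w) (hc : HasCompactSupport w)
    (x : Space 1) : ‖w x‖ₑ ≤ eLpNorm (fderiv ℝ w) 1 volume := by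
  set e : Space 1 := EuclideanSpace.single 0 1 with he
  have hw' : ContDiff ℝ 1 (fun t : ℝ => w (t • e)) :=
    hw.comp (contDiff_id.smul contDiff_const)
  have hmp : MeasurePreserving (fun t : ℝ => t • e) volume volume := by
    have := (PiLp.volume_preserving_toLp (Fin 1)).comp (volume_preserving_funUnique (Fin 1) ℝ).symm
    have hf : (fun t : ℝ => t • e) =
        (WithLp.toLp 2 ∘ (MeasurableEquiv.funUnique (Fin 1) ℝ).symm : ℝ → Space 1) := by
      funext t
      ext i
      fin_cases i
      simp [he, MeasurableEquiv.funUnique]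
    rw [hf]
    exact this
  have hwc : HasCompactSupport (fun t : ℝ => w (t • e)) := by
    refine hc.comp_isClosedEmbedding (g := fun t : ℝ => t • e)
      (LinearMap.isClosedEmbedding_of_injective (f := LinearMap.toSpanSingleton ℝ _ e) ?_)
    rw [LinearMap.ker_toSpanSingleton]
    simp [he]
  have hx : x = x 0 • e := by
    ext i
    fin_cases i
    simp [he]
  have hcont : Continuous (fderiv ℝ w) := hw.continuous_fderiv one_ne_zero
  rw [eLpNorm_one_eq_lintegral_enorm, ← hmp.lintegral_comp hcont.measurable.enorm]
  conv_lhs => rw [hx]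
  refine (HasCompactSupport.enorm_le_lintegral_Ici_deriv hw' hwc (x 0)).trans
    ((setLIntegral_le_lintegral _ _).trans (lintegral_mono fun t => ?_))
  have hder : HasDerivAt (fun t : ℝ => w (t • e)) (fderiv ℝ w (t • e) e) t := by
    have h1 : HasDerivAt (fun t : ℝ => t • e) e t := by
      simpa using (hasDerivAt_id t).smul_const e
    exact ((hw.differentiable one_ne_zero (t • e)).hasFDerivAt).comp_hasDerivAt t h1
  rw [hder.deriv]
  refine (ContinuousLinearMap.le_opENorm _ _).trans ?_
  have h1 : ‖e‖ₑ = 1 := by rw [← ofReal_norm]; simp [he]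
  rw [h1, mul_one]

/-- The Sobolev inequality for smooth functions, including the one-dimensional case. -/
theorem exists_sobolev_smooth (d : ℕ) [NeZero d] (q : ℝ≥0∞) [hq : ENNReal.HolderConjugate d q] :
    ∃ C : ℝ≥0, ∀ w : Space d → ℝ, ContDiff ℝ 1 w → HasCompactSupport w →
      eLpNorm w q volume ≤ C * eLpNorm (fderiv ℝ w) 1 volume := by
  have hsum := ENNReal.HolderConjugate.inv_add_inv_eq_one (d : ℝ≥0∞) q
  rcases eq_or_ne d 1 with rfl | hd
  · have hq : q = ∞ := by simpa using hsum
    subst hq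
    refine ⟨1, fun w hw hc => ?_⟩
    rw [eLpNorm_exponent_top, ENNReal.coe_one, one_mul]
    exact eLpNormEssSup_le_of_ae_enorm_bound
      (Eventually.of_forall fun x => enorm_le_eLpNorm_fderiv hw hc x)
  · have hd2 : 1 < d := by have := NeZero.pos d; omega
    have hqt : q ≠ ∞ := by
      rintro rfl
      simp at hsum
      omega
    lift q to ℝ≥0 using hqt
    refine ⟨eLpNormLESNormFDerivOneConst (volume : Measure (Space d)) q, fun w hw hc => ?_⟩
    refine eLpNorm_le_eLpNorm_fderiv_one volume hw hc ?_
    rw [finrank_euclideanSpace_fin]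
    have : (d : ℝ≥0∞) = ((d : ℝ≥0) : ℝ≥0∞) := by simp
    rw [this] at hq
    have h1 : (1 : ℝ≥0) < ((d : ℝ≥0) : ℝ≥0∞).toNNReal := by simpa using hd2
    simpa using ENNReal.HolderConjugate.toNNReal h1 (q := (q : ℝ≥0∞))

/-- The Sobolev inequality `‖u‖_{d/(d-1)} ≤ C ‖Du‖(ℝᵈ)` on `BV([0, 1]ᵈ)`. -/
theorem exists_sobolev (d : ℕ) [NeZero d] (q : ℝ≥0∞) [ENNReal.HolderConjugate d q] :
    ∃ C : ℝ≥0, ∀ u : Space d → ℝ, MemBV u → eLpNorm u q volume ≤ C * variation u := by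
  obtain ⟨C, hC⟩ := exists_sobolev_smooth d q
  refine ⟨C * d, fun u₀ hu₀ => ?_⟩
  set u : Space d → ℝ := (unitCube d).indicator u₀ with hudef
  have huu : u₀ =ᵐ[volume] u := by
    filter_upwards [hu₀.ae_eq_zero] with x hx
    by_cases h : x ∈ unitCube d
    · simp [hudef, h]
    · simp [hudef, h, hx h]
  have hu : MemBV u := hu₀.congr huu
  rw [eLpNorm_congr_ae huu, variation_congr huu]
  have huc : HasCompactSupport u := by
    refine HasCompactSupport.of_support_subset_isCompact (isCompact_unitCube d) ?_
    exact Set.support_indicator_subset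
  let φ (n : ℕ) : ContDiffBump (0 : Space d) :=
    ⟨1 / (n + 1), 2 * (1 / (n + 1)), by positivity, by
      have : (0 : ℝ) < 1 / (n + 1) := by positivity
      linarith⟩
  let W (n : ℕ) : Space d → ℝ :=
    convolution ((φ n).normed volume) u (ContinuousLinearMap.lsmul ℝ ℝ) volume
  have hWs (n : ℕ) : ContDiff ℝ 2 (W n) :=
    (φ n).hasCompactSupport_normed.contDiff_convolution_left (n := 2) _
      (φ n).contDiff_normed hu.integrable.locallyIntegrable
  have hWc (n : ℕ) : HasCompactSupport (W n) :=
    (φ n).hasCompactSupport_normed.convolution _ huc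
  have hlim : ∀ᵐ x, Tendsto (fun n => W n x) atTop (𝓝 (u x)) := by
    refine ContDiffBump.ae_convolution_tendsto_right_of_locallyIntegrable (K := 2) ?_ ?_
      hu.integrable.locallyIntegrable
    · have := (tendsto_one_div_add_atTop_nhds_zero_nat (𝕜 := ℝ)).const_mul 2
      rw [mul_zero] at this
      exact this
    · exact Eventually.of_forall fun n => le_rfl
  refine (Lp.eLpNorm_lim_le_liminf_eLpNorm
    (fun n => (hWs n).continuous.aestronglyMeasurable) u hlim).trans ?_
  refine liminf_le_of_le (by isBoundedDefault) fun b hb => ?_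
  obtain ⟨n, hn⟩ := hb.exists
  refine hn.trans ((hC _ ((hWs n).of_le (by norm_num)) (hWc n)).trans ?_)
  have hle := variation_convolution_le (φ n) hu.integrable hu.variation_lt_top
  have := (eLpNorm_fderiv_le (hWs n) (hWc n) (hle.trans_lt hu.variation_lt_top)).trans
    (mul_le_mul_right hle _)
  push_cast
  rw [mul_assoc]
  gcongr

end sobolev

/-- Lebesgue measure on `[0, 1]ᵈ`. -/
abbrev cubeMeasure (d : ℕ) : Measure (Space d) := volume.restrict (unitCube d)

instance factOneLe (d : ℕ) [NeZero d] : Fact (1 ≤ (d : ℝ≥0∞)) :=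
  ⟨by exact_mod_cast NeZero.pos d⟩

theorem holder_pairing {α : Type*} [MeasurableSpace α] {μ : Measure α} {p q : ℝ≥0∞}
    (hpq : ENNReal.HolderConjugate p q) {f u : α → ℝ} (hf : MemLp f p μ) (hu : MemLp u q μ) :
    Integrable (fun x => f x * u x) μ ∧
      |∫ x, f x * u x ∂μ| ≤ (eLpNorm f p μ).toReal * (eLpNorm u q μ).toReal := by
  have hint : Integrable (fun x => f x * u x) μ := hf.integrable_mul hu
  have h1 : eLpNorm (fun x => f x * u x) 1 μ ≤ eLpNorm f p μ * eLpNorm u q μ :=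
    eLpNorm_smul_le_mul_eLpNorm (p := p) (q := q) (r := 1) (f := u) (φ := f) hu.1 hf.1
  refine ⟨hint, ?_⟩
  rw [← Real.norm_eq_abs]
  calc ‖∫ x, f x * u x ∂μ‖ ≤ ∫ x, ‖f x * u x‖ ∂μ := norm_integral_le_integral_norm _
    _ = (eLpNorm (fun x => f x * u x) 1 μ).toReal := by
        rw [integral_norm_eq_lintegral_enorm hint.1, eLpNorm_one_eq_lintegral_enorm]
    _ ≤ _ := by
        rw [← ENNReal.toReal_mul]
        exact ENNReal.toReal_mono (ENNReal.mul_ne_top hf.2.ne hu.2.ne) h1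

theorem exists_pairing_bound (d : ℕ) [NeZero d] :
    ∃ C : ℝ, ∀ (f : Lp ℝ d (cubeMeasure d)) (u : BV d),
      Integrable (fun x => f x * u x) (cubeMeasure d) ∧
      |∫ x in unitCube d, f x * u x| ≤ C * ‖f‖ * ‖u‖ := by
  have hq : ENNReal.HolderConjugate (d : ℝ≥0∞) (ENNReal.conjExponent d) :=
    ENNReal.HolderConjugate.conjExponent (Fact.out : 1 ≤ (d : ℝ≥0∞))
  generalize ENNReal.conjExponent (d : ℝ≥0∞) = q at hq
  obtain ⟨C, hC⟩ := exists_sobolev d q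
  refine ⟨C, fun f u => ?_⟩
  have hub := u.memBV
  have hlt : C * variation (u : Space d → ℝ) < ∞ :=
    ENNReal.mul_lt_top ENNReal.coe_lt_top hub.variation_lt_top
  have hle : eLpNorm (u : Space d → ℝ) q (cubeMeasure d) ≤ C * variation (u : Space d → ℝ) :=
    (eLpNorm_mono_measure _ Measure.restrict_le_self).trans (hC _ hub)
  have hu : MemLp (u : Space d → ℝ) q (cubeMeasure d) :=
    ⟨hub.integrable.aestronglyMeasurable.mono_measure Measure.restrict_le_self, hle.trans_lt hlt⟩
  obtain ⟨h1, h2⟩ := holder_pairing hq (Lp.memLp f) hu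
  refine ⟨h1, h2.trans ?_⟩
  have h3 : (eLpNorm (u : Space d → ℝ) q (cubeMeasure d)).toReal ≤ C * ‖u‖ := by
    refine (ENNReal.toReal_mono hlt.ne hle).trans ?_
    rw [ENNReal.toReal_mul, ENNReal.coe_toReal, BV.norm_eq]
    have : 0 ≤ ∫ x, |u x| := integral_nonneg fun x => abs_nonneg _
    exact mul_le_mul_of_nonneg_left (by linarith) C.2
  rw [← Lp.norm_def, mul_comm (C : ℝ), mul_assoc]
  exact mul_le_mul_of_nonneg_left h3 (norm_nonneg f)

/-- The operator `T : L^d([0, 1]ᵈ) → BV([0, 1]ᵈ)^*`, `T_f(u) = ∫_{[0, 1]ᵈ} f u`. -/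
def T (d : ℕ) [NeZero d] : Lp ℝ d (cubeMeasure d) →L[ℝ] StrongDual ℝ (BV d) :=
  LinearMap.mkContinuous₂
    (LinearMap.mk₂ ℝ (fun (f : Lp ℝ d (cubeMeasure d)) (u : BV d) => ∫ x in unitCube d, f x * u x)
      (fun f g u => by
        obtain ⟨C, h⟩ := exists_pairing_bound d
        rw [← integral_add (h f u).1 (h g u).1]
        refine integral_congr_ae ?_
        filter_upwards [Lp.coeFn_add f g] with x hx
        rw [hx, Pi.add_apply, add_mul])
      (fun c f u => by
        rw [smul_eq_mul, ← integral_const_mul]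
        refine integral_congr_ae ?_
        filter_upwards [Lp.coeFn_smul c f] with x hx
        rw [hx, Pi.smul_apply, smul_eq_mul, mul_assoc])
      (fun f u w => by
        obtain ⟨C, h⟩ := exists_pairing_bound d
        rw [← integral_add (h f u).1 (h f w).1]
        refine integral_congr_ae ?_
        filter_upwards [ae_restrict_of_ae (BV.coe_add u w)] with x hx
        rw [hx, mul_add])
      (fun c f u => by
        rw [smul_eq_mul, ← integral_const_mul]
        refine integral_congr_ae ?_
        filter_upwards [ae_restrict_of_ae (BV.coe_smul c u)] with x hx
        rw [hx, mul_left_comm]))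
    (exists_pairing_bound d).choose
    (fun f u => ((exists_pairing_bound d).choose_spec f u).2)

theorem T_apply (d : ℕ) [NeZero d] (f : Lp ℝ d (cubeMeasure d)) (u : BV d) :
    T d f u = ∫ x in unitCube d, f x * u x := rfl

/-- The space `SCH([0, 1]ᵈ)` of strong charge functionals: the closure of the range of `T` in
`BV([0, 1]ᵈ)^*`, with the norm of `BV([0, 1]ᵈ)^*`. -/
def SCH (d : ℕ) [NeZero d] : Submodule ℝ (StrongDual ℝ (BV d)) :=
  (LinearMap.range (T d : Lp ℝ d (cubeMeasure d) →ₗ[ℝ] StrongDual ℝ (BV d))).topologicalClosure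

/-- `T_f` as an element of `SCH([0, 1]ᵈ)`. -/
def strongCharge {d : ℕ} [NeZero d] (f : Lp ℝ d (cubeMeasure d)) : SCH d :=
  ⟨T d f, Submodule.le_topologicalClosure _ ⟨f, rfl⟩⟩

/-- The closed box `∏ [a i, b i]`. -/
def box {d : ℕ} (a b : Fin d → ℝ) : Set (Space d) := {x | ∀ i, x i ∈ Set.Icc (a i) (b i)}

section box

variable {d : ℕ}

theorem box_eq (a b : Fin d → ℝ) : box a b = WithLp.ofLp ⁻¹' Set.Icc a b := by
  ext x
  simp [box, Set.mem_Icc, Pi.le_def, forall_and]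

theorem isCompact_box (a b : Fin d → ℝ) : IsCompact (box a b) := by
  rw [box_eq]
  exact (PiLp.continuousLinearEquiv 2 ℝ (fun _ : Fin d => ℝ)).toHomeomorph.isCompact_preimage.2
    isCompact_Icc

theorem variation_box_lt_top {a b : Fin d → ℝ} (hab : a ≤ b) :
    variation ((box a b).indicator fun _ => (1 : ℝ)) < ∞ := by
  cases d with
  | zero => simp [variation, divergence]
  | succ m =>
  let B : ℝ := ∑ i : Fin (m + 1),
    2 * (volume (Set.Icc (a ∘ i.succAbove) (b ∘ i.succAbove))).toReal
  refine lt_of_le_of_lt (iSup₂_le fun v hv => ENNReal.ofReal_le_ofReal ?_)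
    (ENNReal.ofReal_lt_top (r := B))
  let L := (PiLp.continuousLinearEquiv 2 ℝ (fun _ : Fin (m + 1) => ℝ)).symm
  have hL (y : Fin (m + 1) → ℝ) : L y = WithLp.toLp 2 y := rfl
  have hmp : MeasurePreserving L volume volume := PiLp.volume_preserving_toLp (Fin (m + 1))
  have hme : MeasurableEmbedding L := L.toHomeomorph.measurableEmbedding
  have hpre : L ⁻¹' box a b = Set.Icc a b := by
    ext y
    simp [box, hL, Set.mem_Icc, Pi.le_def, forall_and]
  have hvL : ContDiff ℝ 1 (fun y => v (L y)) := hv.contDiff.comp L.contDiff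
  let f' (i : Fin (m + 1)) (y : Fin (m + 1) → ℝ) : (Fin (m + 1) → ℝ) →L[ℝ] ℝ :=
    (EuclideanSpace.proj i : Space (m + 1) →L[ℝ] ℝ) ∘L
      (fderiv ℝ v (L y)) ∘L (L : (Fin (m + 1) → ℝ) →L[ℝ] Space (m + 1))
  have hdiv (y : Fin (m + 1) → ℝ) :
      divergence v (L y) = ∑ i, f' i y (Pi.single i 1) := by
    simp only [divergence, f']
    rfl
  have hder (y : Fin (m + 1) → ℝ) (i : Fin (m + 1)) :
      HasFDerivAt (fun y => v (L y) i) (f' i y) y := by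
    have h1 : HasFDerivAt v (fderiv ℝ v (L y)) (L y) :=
      (hv.contDiff.differentiable one_ne_zero (L y)).hasFDerivAt
    exact (EuclideanSpace.proj i : Space (m + 1) →L[ℝ] ℝ).hasFDerivAt.comp y
      (h1.comp y L.hasFDerivAt)
  have hcd : Continuous fun y => divergence v (L y) := hv.continuous_divergence.comp L.continuous
  have hthm := integral_divergence_of_hasFDerivAt_off_countable' a b hab
    (fun i y => v (L y) i) f' ∅ Set.countable_empty
    (fun i y _ => (hder y i).continuousAt.continuousWithinAt)
    (fun y _ i => hder y i)
    (by
      simp only [← hdiv]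
      exact hcd.continuousOn.integrableOn_compact isCompact_Icc)
  have hface (i : Fin (m + 1)) (c : ℝ) :
      |∫ y in Set.Icc (a ∘ i.succAbove) (b ∘ i.succAbove), v (L (i.insertNth c y)) i| ≤
        (volume (Set.Icc (a ∘ i.succAbove) (b ∘ i.succAbove))).toReal := by
    have := norm_setIntegral_le_of_norm_le_const (μ := volume)
      (s := Set.Icc (a ∘ i.succAbove) (b ∘ i.succAbove))
      (f := fun y => v (L (i.insertNth c y)) i) (C := 1)
      isCompact_Icc.measure_lt_top
      (fun y _ => (PiLp.norm_apply_le _ i).trans (hv.norm_le_one _))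
    simpa [Measure.real] using this
  calc ∫ x, (box a b).indicator (fun _ => (1 : ℝ)) x * divergence v x
      = ∫ x in box a b, divergence v x := by
        rw [← integral_indicator (isCompact_box a b).measurableSet]
        congr 1
        ext x
        by_cases hx : x ∈ box a b <;> simp [hx]
    _ = ∫ y in Set.Icc a b, divergence v (L y) := by
        rw [← hpre, hmp.setIntegral_preimage_emb hme]
    _ = _ := by
        simp only [hdiv]
        exact hthm
    _ ≤ B := by
        refine Finset.sum_le_sum fun i _ => ?_
        have h1 := abs_le.1 (hface i (b i))
        have h2 := abs_le.1 (hface i (a i))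
        linarith

theorem memBV_box {a b : Fin d → ℝ} (hab : a ≤ b) (h : box a b ⊆ unitCube d) :
    MemBV ((box a b).indicator fun _ => (1 : ℝ)) :=
  ⟨(integrable_indicator_iff (isCompact_box a b).measurableSet).2
      (integrableOn_const (isCompact_box a b).measure_lt_top.ne),
    variation_box_lt_top hab,
    Eventually.of_forall fun _ hx => Set.indicator_of_notMem (fun hx' => hx (h hx')) _⟩

end box

/-- Dyadic cubes of generation `n` in `[0, 1]ᵈ`. -/
def IsDyadicCube {d : ℕ} (n : ℕ) (Q : Set (Space d)) : Prop :=
  ∃ c : Fin d → ℕ, (∀ i, c i < 2 ^ n) ∧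
    Q = box (fun i => (c i : ℝ) / 2 ^ n) (fun i => ((c i : ℝ) + 1) / 2 ^ n)

theorem isDyadicCube_unitCube (d : ℕ) : IsDyadicCube 0 (unitCube d) :=
  ⟨fun _ => 0, by simp, by simp [unitCube, box]⟩

theorem IsDyadicCube.measurableSet {d n : ℕ} {Q : Set (Space d)} (h : IsDyadicCube n Q) :
    MeasurableSet Q := by
  obtain ⟨c, -, rfl⟩ := h
  exact (isCompact_box _ _).measurableSet

theorem IsDyadicCube.memBV {d n : ℕ} {Q : Set (Space d)} (h : IsDyadicCube n Q) :
    MemBV (Q.indicator fun _ => (1 : ℝ)) := by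
  obtain ⟨c, hc, rfl⟩ := h
  refine memBV_box (fun i => ?_) fun x hx i => ⟨le_trans (by positivity) (hx i).1,
    (hx i).2.trans ?_⟩
  · dsimp only
    gcongr
    linarith
  · rw [div_le_one (by positivity)]
    exact_mod_cast hc i

/-- A numbering `K_{n,k}`, `0 ≤ k < 2^{nd}`, of the dyadic cubes of each generation `n` such that
`K_{n+1, 2^d k}, …, K_{n+1, 2^d k + 2^d - 1}` are the `2^d` subcubes of `K_{n,k}` of generation
`n + 1`. (The values for `k ≥ 2^{nd}` are irrelevant.) -/
structure DyadicNumbering (d : ℕ) where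
  cube : ℕ → ℕ → Set (Space d)
  bijOn : ∀ n, Set.BijOn (cube n) (Set.Iio (2 ^ (n * d))) {Q | IsDyadicCube n Q}
  image_children : ∀ n, ∀ k < 2 ^ (n * d),
    (fun l => cube (n + 1) (2 ^ d * k + l)) '' Set.Iio (2 ^ d) =
      {Q | IsDyadicCube (n + 1) Q ∧ Q ⊆ cube n k}

/-- The matrix `A_d` of order `2^d`: `A_0 = (1)` and `A_{d+1} = [A_d, A_d; A_d, -A_d]`. -/
def haarMatrix : (d : ℕ) → Matrix (Fin (2 ^ d)) (Fin (2 ^ d)) ℝ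
  | 0 => 1
  | d + 1 =>
    let e : Fin (2 ^ d) ⊕ Fin (2 ^ d) ≃ Fin (2 ^ (d + 1)) :=
      finSumFinEquiv.trans (finCongr (by rw [pow_succ, mul_two]))
    Matrix.reindex e e
      (Matrix.fromBlocks (haarMatrix d) (haarMatrix d) (haarMatrix d) (-haarMatrix d))

section haar

variable {d : ℕ} (K : DyadicNumbering d)

/-- The Haar function `g_{n,k,r}`, extended by `0` outside `[0, 1]ᵈ`. -/
def haar (n k : ℕ) (r : Fin (2 ^ d)) (x : Space d) : ℝ :=
  2 ^ ((n * d : ℝ) / 2) * ∑ l : Fin (2 ^ d),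
    haarMatrix d r l * (K.cube (n + 1) (2 ^ d * k + l)).indicator (fun _ => 1) x

/-- The generation number of the `j`-th Haar function, `j ≥ 1`. There are `2^{nd}` Haar functions
of generation less than `n` (the constant `g_{-1}` included), so that generation `n` occupies the
positions `2^{nd} ≤ j < 2^{(n+1)d}`. -/
def haarGen (d j : ℕ) : ℕ := Nat.log (2 ^ d) j

/-- The cube number of the `j`-th Haar function, `j ≥ 1`. -/
def haarCube (d j : ℕ) : ℕ := (j - 2 ^ (haarGen d j * d)) / (2 ^ d - 1)

/-- The type number of the `j`-th Haar function, `j ≥ 1`. -/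
def haarType (d j : ℕ) [NeZero d] : Fin (2 ^ d) :=
  ⟨(j - 2 ^ (haarGen d j * d)) % (2 ^ d - 1) + 1, by
    have h : 1 < 2 ^ d := Nat.one_lt_two_pow (NeZero.ne d)
    have := Nat.mod_lt (j - 2 ^ (haarGen d j * d)) (by omega : 0 < 2 ^ d - 1)
    omega⟩

theorem isDyadicCube_child {n k : ℕ} (hk : k < 2 ^ (n * d)) (l : Fin (2 ^ d)) :
    IsDyadicCube (n + 1) (K.cube (n + 1) (2 ^ d * k + l)) :=
  ((K.image_children n k hk).subset ⟨l, l.2, rfl⟩).1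

variable [NeZero d]

/-- The Haar functions `g_{-1}, g_{0,0,1}, g_{0,0,2}, …`, with the indices `(n, k, r)`,
`0 ≤ k < 2^{nd}`, `1 ≤ r < 2^d`, in lexicographic order. -/
def haarSeq : ℕ → Space d → ℝ
  | 0 => (unitCube d).indicator fun _ => 1
  | j + 1 => haar K (haarGen d (j + 1)) (haarCube d (j + 1)) (haarType d (j + 1))

/-- In the sequence `haarSeq`, the function `g_{n,k,r}` has position
`2^{nd} + k (2^d - 1) + (r - 1)`. -/
theorem haarSeq_index (n k : ℕ) (hk : k < 2 ^ (n * d)) (r : Fin (2 ^ d)) (hr : 1 ≤ (r : ℕ)) :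
    haarSeq K (2 ^ (n * d) + k * (2 ^ d - 1) + (r - 1)) = haar K n k r := by
  have h1 : 1 < 2 ^ d := Nat.one_lt_two_pow (NeZero.ne d)
  have hpos : 0 < 2 ^ (n * d) := by positivity
  have hm : k * (2 ^ d - 1) + (r - 1) < 2 ^ (n * d) * (2 ^ d - 1) := by
    have := r.2
    calc k * (2 ^ d - 1) + (r - 1) < k * (2 ^ d - 1) + (2 ^ d - 1) := by omega
      _ = (k + 1) * (2 ^ d - 1) := by ring
      _ ≤ _ := Nat.mul_le_mul_right _ hk
  have hub : 2 ^ (n * d) * (2 ^ d - 1) + 2 ^ (n * d) = 2 ^ ((n + 1) * d) := by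
    rw [← Nat.mul_succ, Nat.succ_eq_add_one, Nat.sub_add_cancel h1.le, ← pow_add]
    ring
  obtain ⟨j, hj⟩ : ∃ j, 2 ^ (n * d) + k * (2 ^ d - 1) + (r - 1) = j + 1 :=
    ⟨2 ^ (n * d) + k * (2 ^ d - 1) + (r - 1) - 1, by omega⟩
  have hgen : haarGen d (j + 1) = n := by
    unfold haarGen
    rw [Nat.log_eq_iff (Or.inr ⟨h1, by omega⟩), ← pow_mul, ← pow_mul, mul_comm d n,
      mul_comm d (n + 1)]
    omega
  have hsub : j + 1 - 2 ^ (n * d) = (r - 1) + (2 ^ d - 1) * k := by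
    rw [← hj, mul_comm k]
    omega
  have hr' : (r : ℕ) - 1 < 2 ^ d - 1 := by have := r.2; omega
  have hcube : haarCube d (j + 1) = k := by
    unfold haarCube
    rw [hgen, hsub, Nat.add_mul_div_left _ _ (by omega), Nat.div_eq_of_lt hr', zero_add]
  have htype : haarType d (j + 1) = r := by
    apply Fin.ext
    simp only [haarType]
    rw [hgen, hsub, Nat.add_mul_mod_self_left, Nat.mod_eq_of_lt hr']
    omega
  rw [hj, haarSeq, hgen, hcube, htype]

theorem haarCube_lt (j : ℕ) : haarCube d (j + 1) < 2 ^ (haarGen d (j + 1) * d) := by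
  have h1 : 1 < 2 ^ d := Nat.one_lt_two_pow (NeZero.ne d)
  have hlt := Nat.lt_pow_succ_log_self h1 (j + 1)
  unfold haarCube
  rw [Nat.div_lt_iff_lt_mul (by omega)]
  change j + 1 < (2 ^ d) ^ (haarGen d (j + 1) + 1) at hlt
  set n := haarGen d (j + 1)
  have hub : 2 ^ (n * d) * (2 ^ d - 1) + 2 ^ (n * d) = (2 ^ d) ^ (n + 1) := by
    rw [← Nat.mul_succ, Nat.succ_eq_add_one, Nat.sub_add_cancel h1.le, ← pow_add, ← pow_mul]
    ring
  have : 0 < 2 ^ (n * d) * (2 ^ d - 1) := Nat.mul_pos (by positivity) (by omega)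
  omega

theorem memBV_haarSeq (j : ℕ) : MemBV (haarSeq K j) := by
  cases j with
  | zero => exact (isDyadicCube_unitCube d).memBV
  | succ j =>
    exact (MemBV.sum _ fun l _ =>
      (isDyadicCube_child K (haarCube_lt j) l).memBV.const_mul _).const_mul _

theorem memLp_haarSeq (j : ℕ) : MemLp (haarSeq K j) d (cubeMeasure d) := by
  have : IsFiniteMeasure (cubeMeasure d) :=
    ⟨by simpa using (isCompact_unitCube d).measure_lt_top⟩
  have h (n : ℕ) (Q : Set (Space d)) (hQ : IsDyadicCube n Q) :
      MemLp (Q.indicator fun _ => (1 : ℝ)) d (cubeMeasure d) :=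
    (memLp_const 1).indicator hQ.measurableSet
  cases j with
  | zero => exact h 0 _ (isDyadicCube_unitCube d)
  | succ j =>
    exact (memLp_finsetSum _ fun l _ =>
      (h _ _ (isDyadicCube_child K (haarCube_lt j) l)).const_mul _).const_mul _

/-- The Haar functions as elements of `BV([0, 1]ᵈ)`. -/
def haarBV (j : ℕ) : BV d := BV.mk (haarSeq K j) (memBV_haarSeq K j)

/-- The Haar functions as elements of `L^d([0, 1]ᵈ)`. -/
def haarLp (j : ℕ) : Lp ℝ d (cubeMeasure d) := (memLp_haarSeq K j).toLp (haarSeq K j)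

/-- The sequence `T_{g_{-1}}, T_{g_{0,0,1}}, T_{g_{0,0,2}}, …` in `SCH([0, 1]ᵈ)`. -/
def haarCharge (j : ℕ) : SCH d := strongCharge (haarLp K j)

end haar

end

end StrongCharge

open StrongCharge

/-!
At a complete generation `n` the partial sum of the Haar series of `u` is the conditional
expectation of `u` on the dyadic cubes of side `2⁻ⁿ`. By the divergence theorem its variation is at
most the area of a face times the sum of the jumps between neighbouring cubes, and translating `u`
by `2⁻ⁿ` costs at most `d 2⁻ⁿ ‖Du‖` in `L¹`; the powers of `2` cancel. An incomplete generation is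
bounded term by term: its coefficients sum to `O(2^{nd/2} 2⁻ⁿ ‖Du‖)`, while each Haar function has
norm `O(2^{nd/2} 2^{-n(d-1)})`. Hence the partial sums are uniformly bounded operators on
`BV([0, 1]ᵈ)`, and so are their adjoints on the dual. By orthonormality the adjoints are eventually
the identity on each `T_g`; they therefore converge strongly to the identity on the closed span of
the `T_g`, which contains `SCH` because the Haar functions span a dense subspace of `L^d` and `T` is
continuous.
-/

namespace StrongCharge

section translation

theorem lintegral_enorm_translate_sub_le {E F : Type*} [NormedAddCommGroup E] [NormedSpace ℝ E]
    [MeasurableSpace E] [BorelSpace E]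
    [NormedAddCommGroup F] [NormedSpace ℝ F] [CompleteSpace F]
    (μ : Measure E) [SFinite μ] [μ.IsAddRightInvariant] {w : E → F} (hw : ContDiff ℝ 1 w) (t : E) :
    ∫⁻ x, ‖w (x + t) - w x‖ₑ ∂μ ≤ ‖t‖ₑ * eLpNorm (fderiv ℝ w) 1 μ := by
  have hcont : Continuous (fderiv ℝ w) := hw.continuous_fderiv one_ne_zero
  have enorm_sub_le (x : E) :
      ‖w (x + t) - w x‖ₑ ≤ ∫⁻ s in Set.Ioc (0 : ℝ) 1, ‖fderiv ℝ w (x + s • t) t‖ₑ := by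
    have hline (s : ℝ) : HasDerivAt (fun s : ℝ => x + s • t) t s := by
      simpa using ((hasDerivAt_id s).smul_const t).const_add x
    have hderiv (s : ℝ) :
        HasDerivAt (fun s : ℝ => w (x + s • t)) (fderiv ℝ w (x + s • t) t) s :=
      (hw.differentiable one_ne_zero _).hasFDerivAt.comp_hasDerivAt s (hline s)
    have hFTC := intervalIntegral.integral_eq_sub_of_hasDerivAt (a := 0) (b := 1)
      (fun s _ => hderiv s) ((by fun_prop : Continuous _).intervalIntegrable _ _)
    simp only [one_smul, zero_smul, add_zero] at hFTC
    rw [← hFTC, intervalIntegral.integral_of_le zero_le_one]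
    exact enorm_integral_le_lintegral_enorm _
  have hmeas : Measurable (Function.uncurry fun (x : E) (s : ℝ) =>
      ‖fderiv ℝ w (x + s • t) t‖ₑ) :=
    (by fun_prop : Continuous fun p : E × ℝ => ‖fderiv ℝ w (p.1 + p.2 • t) t‖ₑ).measurable
  calc ∫⁻ x, ‖w (x + t) - w x‖ₑ ∂μ
      ≤ ∫⁻ x, (∫⁻ s in Set.Ioc (0 : ℝ) 1, ‖fderiv ℝ w (x + s • t) t‖ₑ) ∂μ :=
        lintegral_mono enorm_sub_le
    _ = ∫⁻ s in Set.Ioc (0 : ℝ) 1, ∫⁻ x, ‖fderiv ℝ w (x + s • t) t‖ₑ ∂μ :=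
        lintegral_lintegral_swap hmeas.aemeasurable
    _ = ∫⁻ _s in Set.Ioc (0 : ℝ) 1, ∫⁻ x, ‖fderiv ℝ w x t‖ₑ ∂μ :=
        lintegral_congr fun s =>
          lintegral_add_right_eq_self (fun x => ‖fderiv ℝ w x t‖ₑ) (s • t)
    _ = ∫⁻ x, ‖fderiv ℝ w x t‖ₑ ∂μ := by simp
    _ ≤ ∫⁻ x, ‖t‖ₑ * ‖fderiv ℝ w x‖ₑ ∂μ :=
        lintegral_mono fun x => (ContinuousLinearMap.le_opENorm _ _).trans_eq (mul_comm _ _)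
    _ = ‖t‖ₑ * eLpNorm (fderiv ℝ w) 1 μ := by
        rw [lintegral_const_mul _ hcont.enorm.measurable, eLpNorm_one_eq_lintegral_enorm]

variable {d : ℕ} {u : Space d → ℝ}

theorem exists_smooth_ae_tendsto_of_variation_lt_top (hu : Integrable u)
    (hsupp : HasCompactSupport u) (hvar : variation u < ∞) :
    ∃ W : ℕ → Space d → ℝ, (∀ n, ContDiff ℝ 2 (W n)) ∧ (∀ n, HasCompactSupport (W n)) ∧
      (∀ n, variation (W n) ≤ variation u) ∧
      ∀ᵐ x, Tendsto (fun n => W n x) atTop (𝓝 (u x)) := by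
  let φ (n : ℕ) : ContDiffBump (0 : Space d) :=
    ⟨1 / (n + 1), 2 * (1 / (n + 1)), by positivity,
      lt_mul_left (by positivity) one_lt_two⟩
  refine ⟨fun n => convolution ((φ n).normed volume) u (ContinuousLinearMap.lsmul ℝ ℝ) volume,
    fun n => (φ n).hasCompactSupport_normed.contDiff_convolution_left (n := 2) _
      (φ n).contDiff_normed hu.locallyIntegrable,
    fun n => (φ n).hasCompactSupport_normed.convolution _ hsupp,
    fun n => variation_convolution_le (φ n) hu hvar,
    ContDiffBump.ae_convolution_tendsto_right_of_locallyIntegrable (K := 2) ?_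
      (Eventually.of_forall fun n => le_rfl) hu.locallyIntegrable⟩
  simpa only [mul_zero] using (tendsto_one_div_add_atTop_nhds_zero_nat (𝕜 := ℝ)).const_mul 2

theorem lintegral_enorm_translate_sub_le_variation (hu : Integrable u)
    (hsupp : HasCompactSupport u) (hvar : variation u < ∞) (t : Space d) :
    ∫⁻ x, ‖u (x + t) - u x‖ₑ ≤ ‖t‖ₑ * (d * variation u) := by
  obtain ⟨W, hW, hWsupp, hWvar, hlim⟩ := exists_smooth_ae_tendsto_of_variation_lt_top hu hsupp hvar
  have hlim_sub : ∀ᵐ x, Tendsto (fun n => W n (x + t) - W n x) atTop (𝓝 (u (x + t) - u x)) := by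
    filter_upwards [hlim,
      (measurePreserving_add_right volume t).quasiMeasurePreserving.ae hlim] with x hx hxt
    exact hxt.sub hx
  have hle (n : ℕ) : ∫⁻ x, ‖W n (x + t) - W n x‖ₑ ≤ ‖t‖ₑ * (d * variation u) :=
    calc ∫⁻ x, ‖W n (x + t) - W n x‖ₑ
        ≤ ‖t‖ₑ * eLpNorm (fderiv ℝ (W n)) 1 volume :=
          lintegral_enorm_translate_sub_le volume ((hW n).of_le (by norm_num)) t
      _ ≤ ‖t‖ₑ * (d * variation (W n)) := by
          gcongr
          exact eLpNorm_fderiv_le (hW n) (hWsupp n) ((hWvar n).trans_lt hvar)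
      _ ≤ ‖t‖ₑ * (d * variation u) := by gcongr; exact hWvar n
  have hmeas (n : ℕ) : AEStronglyMeasurable (fun x => W n (x + t) - W n x) volume := by
    have := (hW n).continuous
    exact (by fun_prop : Continuous fun x => W n (x + t) - W n x).aestronglyMeasurable
  rw [← eLpNorm_one_eq_lintegral_enorm (f := fun x => u (x + t) - u x)]
  refine (Lp.eLpNorm_lim_le_liminf_eLpNorm hmeas _ hlim_sub).trans
    (liminf_le_of_frequently_le' (Frequently.of_forall fun n => ?_))
  simpa only [eLpNorm_one_eq_lintegral_enorm] using hle n

theorem MemBV.ae_eq_indicator (hu : MemBV u) : u =ᵐ[volume] (unitCube d).indicator u := by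
  filter_upwards [hu.ae_eq_zero] with x hx
  by_cases h : x ∈ unitCube d
  · rw [Set.indicator_of_mem h]
  · rw [Set.indicator_of_notMem h, hx h]

theorem integrable_translate_sub (hu : Integrable u) (t : Space d) :
    Integrable fun x => u (x + t) - u x :=
  (hu.comp_add_right t).sub hu

theorem MemBV.lintegral_enorm_translate_sub_le (hu : MemBV u) (t : Space d) :
    ∫⁻ x, ‖u (x + t) - u x‖ₑ ≤ ‖t‖ₑ * (d * variation u) := by
  have hae := hu.ae_eq_indicator
  have hae_translate := (measurePreserving_add_right volume t).quasiMeasurePreserving.ae hae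
  have hind := hu.congr hae
  rw [variation_congr hae]
  refine (lintegral_congr_ae ?_).trans_le (lintegral_enorm_translate_sub_le_variation
    hind.integrable (.of_support_subset_isCompact (isCompact_unitCube d)
      Set.support_indicator_subset) hind.variation_lt_top t)
  filter_upwards [hae, hae_translate] with x hx hxt
  rw [← hx, ← hxt]

theorem MemBV.integral_abs_translate_sub_le (hu : MemBV u) (t : Space d) :
    ∫ x, |u (x + t) - u x| ≤ d * ‖t‖ * (variation u).toReal := by
  have h := hu.lintegral_enorm_translate_sub_le t
  rw [← ofReal_integral_norm_eq_lintegral_enorm (integrable_translate_sub hu.integrable t),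
    ENNReal.ofReal_le_iff_le_toReal (ENNReal.mul_ne_top enorm_ne_top
      (ENNReal.mul_ne_top (ENNReal.natCast_ne_top d) hu.variation_lt_top.ne))] at h
  simp only [ENNReal.toReal_mul, ENNReal.toReal_natCast, toReal_enorm, Real.norm_eq_abs] at h
  linarith

theorem MemBV.integral_abs_le [NeZero d] (hu : MemBV u) :
    ∫ x, |u x| ≤ 2 * d * (variation u).toReal := by
  let t : Space d := EuclideanSpace.single 0 2
  have hdisjoint {x : Space d} (hx : x ∈ unitCube d) : x + t ∉ unitCube d := fun hxt => by
    have h0 := (hx 0).1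
    have h1 := (hxt 0).2
    simp only [t, PiLp.add_apply, PiLp.single_apply, if_true] at h1
    linarith
  have hle : ∀ᵐ x, |u x| ≤ |u (x + t) - u x| := by
    filter_upwards [hu.ae_eq_zero,
      (measurePreserving_add_right volume t).quasiMeasurePreserving.ae hu.ae_eq_zero] with x hx hxt
    by_cases h : x ∈ unitCube d
    · simp [hxt (hdisjoint h)]
    · simp [hx h]
  calc ∫ x, |u x| ≤ ∫ x, |u (x + t) - u x| :=
        integral_mono_ae hu.integrable.abs (integrable_translate_sub hu.integrable t).abs hle
    _ ≤ d * ‖t‖ * (variation u).toReal := hu.integral_abs_translate_sub_le t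
    _ = 2 * d * (variation u).toReal := by simp [t, mul_comm]

end translation

section flux

/-- The flux of `v` through the slice `x i = t` of the box with corners `a` and `b`. -/
noncomputable def boxFlux {m : ℕ} (v : Space (m + 1) → Space (m + 1)) (a b : Fin (m + 1) → ℝ)
    (i : Fin (m + 1)) (t : ℝ) : ℝ :=
  ∫ y in Set.Icc (a ∘ i.succAbove) (b ∘ i.succAbove), v (WithLp.toLp 2 (i.insertNth t y)) i

variable {m : ℕ} {v : Space (m + 1) → Space (m + 1)} {a b : Fin (m + 1) → ℝ}

theorem abs_boxFlux_le (hv : ∀ x, ‖v x‖ ≤ 1) (hab : a ≤ b) (i : Fin (m + 1)) (t : ℝ) :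
    |boxFlux v a b i t| ≤ ∏ j, (b (i.succAbove j) - a (i.succAbove j)) := by
  refine (norm_setIntegral_le_of_norm_le_const (μ := volume) isCompact_Icc.measure_lt_top
    fun y _ => (PiLp.norm_apply_le _ i).trans (hv _)).trans_eq ?_
  rw [one_mul, measureReal_def]
  exact Real.volume_Icc_pi_toReal fun j => hab _

theorem setIntegral_box_divergence (hv : ContDiff ℝ 1 v) (hab : a ≤ b) :
    ∫ x in box a b, divergence v x = ∑ i, (boxFlux v a b i (b i) - boxFlux v a b i (a i)) := by
  let L := (PiLp.continuousLinearEquiv 2 ℝ (fun _ : Fin (m + 1) => ℝ)).symm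
  let v' (i : Fin (m + 1)) (y : Fin (m + 1) → ℝ) : (Fin (m + 1) → ℝ) →L[ℝ] ℝ :=
    (EuclideanSpace.proj i : Space (m + 1) →L[ℝ] ℝ) ∘L
      (fderiv ℝ v (L y)) ∘L (L : (Fin (m + 1) → ℝ) →L[ℝ] Space (m + 1))
  have hasFDerivAt_comp (y : Fin (m + 1) → ℝ) (i : Fin (m + 1)) :
      HasFDerivAt (fun y => v (L y) i) (v' i y) y :=
    (EuclideanSpace.proj i : Space (m + 1) →L[ℝ] ℝ).hasFDerivAt.comp y
      ((hv.differentiable one_ne_zero (L y)).hasFDerivAt.comp y L.hasFDerivAt)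
  have divergence_comp (y : Fin (m + 1) → ℝ) :
      divergence v (L y) = ∑ i, v' i y (Pi.single i 1) := rfl
  have continuous_divergence : Continuous fun y => divergence v (L y) := by
    have := hv.continuous_fderiv one_ne_zero
    unfold divergence
    fun_prop
  have preimage_box : L ⁻¹' box a b = Set.Icc a b := by
    ext y
    simp [box, L, Set.mem_Icc, Pi.le_def, forall_and]
  rw [← (PiLp.volume_preserving_toLp (Fin (m + 1))).setIntegral_preimage_emb
    L.toHomeomorph.measurableEmbedding]
  change ∫ y in L ⁻¹' box a b, divergence v (L y) = _
  rw [preimage_box]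
  simp only [divergence_comp] at continuous_divergence ⊢
  exact integral_divergence_of_hasFDerivAt_off_countable' a b hab (fun i y => v (L y) i) v' ∅
    Set.countable_empty (fun i y _ => (hasFDerivAt_comp y i).continuousAt.continuousWithinAt)
    (fun y _ i => hasFDerivAt_comp y i)
    (continuous_divergence.continuousOn.integrableOn_compact isCompact_Icc)

end flux

section cell

variable {d : ℕ} {n : ℕ} {c : Fin d → ℤ} {x : Space d}

/-- The index of the half-open dyadic cube of side `2⁻ⁿ` that contains `x`. -/
noncomputable def cellIndex (n : ℕ) (x : Space d) : Fin d → ℤ := fun i => ⌊2 ^ n * x i⌋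

/-- The half-open dyadic cube of side `2⁻ⁿ` with index `c`. Unlike the closed dyadic cubes, those
of a given generation partition the space. -/
def cell (n : ℕ) (c : Fin d → ℤ) : Set (Space d) := {x | cellIndex n x = c}

theorem mem_cell : x ∈ cell n c ↔ cellIndex n x = c :=
  Iff.rfl

theorem mem_cell_iff :
    x ∈ cell n c ↔ ∀ i, (c i : ℝ) / 2 ^ n ≤ x i ∧ x i < ((c i : ℝ) + 1) / 2 ^ n := by
  have h2 : (0 : ℝ) < 2 ^ n := by positivity
  simp only [mem_cell, funext_iff, cellIndex, Int.floor_eq_iff, div_le_iff₀ h2, lt_div_iff₀ h2,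
    mul_comm]

theorem cell_eq_preimage (n : ℕ) (c : Fin d → ℤ) :
    cell n c = WithLp.ofLp ⁻¹' (Set.univ.pi fun i =>
      Set.Ico ((c i : ℝ) / 2 ^ n) (((c i : ℝ) + 1) / 2 ^ n)) := by
  ext x
  simp [mem_cell_iff, Set.mem_Ico]

theorem measurableSet_cell (n : ℕ) (c : Fin d → ℤ) : MeasurableSet (cell n c) := by
  rw [cell_eq_preimage]
  exact (PiLp.volume_preserving_ofLp (Fin d)).measurable
    (MeasurableSet.univ_pi fun i => measurableSet_Ico)

/-- The closed dyadic cube of side `2⁻ⁿ` with index `c`. -/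
def closedCell (n : ℕ) (c : Fin d → ℤ) : Set (Space d) :=
  box (fun i => (c i : ℝ) / 2 ^ n) (fun i => ((c i : ℝ) + 1) / 2 ^ n)

theorem cell_ae_eq_closedCell (n : ℕ) (c : Fin d → ℤ) :
    cell n c =ᵐ[volume] closedCell n c := by
  rw [cell_eq_preimage, closedCell, box_eq]
  exact (PiLp.volume_preserving_ofLp (Fin d)).quasiMeasurePreserving.preimage_ae_eq
    Measure.univ_pi_Ico_ae_eq_Icc

theorem unitCube_ae_eq_cell (d : ℕ) : unitCube d =ᵐ[volume] cell 0 0 := by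
  have : unitCube d = closedCell 0 0 := by simp [unitCube, closedCell, box]
  exact this ▸ (cell_ae_eq_closedCell 0 0).symm

theorem volume_real_cell (n : ℕ) (c : Fin d → ℤ) :
    volume.real (cell n c) = (((2 : ℝ) ^ n)⁻¹) ^ d := by
  have hside (i : Fin d) : ((c i : ℝ) + 1) / 2 ^ n - (c i : ℝ) / 2 ^ n = ((2 : ℝ) ^ n)⁻¹ := by
    ring
  rw [cell_eq_preimage, measureReal_def,
    (PiLp.volume_preserving_ofLp (Fin d)).measure_preimage
      (MeasurableSet.univ_pi fun i => measurableSet_Ico).nullMeasurableSet, volume_pi_pi]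
  simp only [Real.volume_Ico, hside, Finset.prod_const, Finset.card_univ, Fintype.card_fin,
    ENNReal.toReal_pow]
  rw [ENNReal.toReal_ofReal (by positivity)]

theorem setAverage_cell (n : ℕ) (c : Fin d → ℤ) (f : Space d → ℝ) :
    ⨍ x in cell n c, f x = 2 ^ (n * d) * ∫ x in cell n c, f x := by
  rw [setAverage_eq, volume_real_cell, smul_eq_mul, inv_pow, inv_inv, pow_mul]

theorem disjoint_cell {c c' : Fin d → ℤ} (h : c ≠ c') : Disjoint (cell n c) (cell n c') :=
  Set.disjoint_left.2 fun _ hx hx' => h (hx.symm.trans hx')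

theorem cellIndex_mem_of_mem_cell_zero (hx : x ∈ cell 0 0) (n : ℕ) (i : Fin d) :
    0 ≤ cellIndex n x i ∧ cellIndex n x i < 2 ^ n := by
  have h := mem_cell_iff.1 hx i
  simp only [Pi.zero_apply, Int.cast_zero, pow_zero, div_one, zero_add] at h
  have h2 : (0 : ℝ) < 2 ^ n := by positivity
  refine ⟨Int.floor_nonneg.2 (mul_nonneg h2.le h.1), Int.floor_lt.2 ?_⟩
  push_cast
  nlinarith [h.2]

theorem norm_le_sum_abs (x : Space d) : ‖x‖ ≤ ∑ i, |x i| := by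
  calc ‖x‖ = ‖∑ i, x i • EuclideanSpace.basisFun (Fin d) ℝ i‖ :=
        congrArg norm ((EuclideanSpace.basisFun (Fin d) ℝ).sum_repr x).symm
    _ ≤ ∑ i, ‖x i • EuclideanSpace.basisFun (Fin d) ℝ i‖ := norm_sum_le _ _
    _ = ∑ i, |x i| := by simp [norm_smul]

/-- The translation that moves each dyadic cell of generation `n` by `e` cells. -/
noncomputable def dyadicVector (n : ℕ) (e : Fin d → ℤ) : Space d :=
  WithLp.toLp 2 fun i => e i / 2 ^ n

theorem cellIndex_add_dyadicVector (n : ℕ) (x : Space d) (e : Fin d → ℤ) :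
    cellIndex n (x + dyadicVector n e) = cellIndex n x + e := by
  funext i
  have hpow : (2 : ℝ) ^ n ≠ 0 := by positivity
  simp only [cellIndex, dyadicVector, PiLp.add_apply, Pi.add_apply, mul_add, mul_div_cancel₀ _ hpow,
    Int.floor_add_intCast]

theorem norm_dyadicVector_le (n : ℕ) (e : Fin d → ℤ) :
    ‖dyadicVector n e‖ ≤ (∑ i, |(e i : ℝ)|) * ((2 : ℝ) ^ n)⁻¹ := by
  refine (norm_le_sum_abs _).trans_eq ?_
  simp [dyadicVector, Finset.sum_mul, div_eq_mul_inv]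

theorem setIntegral_cell_add (n : ℕ) (c e : Fin d → ℤ) (f : Space d → ℝ) :
    ∫ x in cell n (c + e), f x = ∫ x in cell n c, f (x + dyadicVector n e) := by
  rw [← (measurePreserving_add_right volume (dyadicVector n e)).setIntegral_preimage_emb
    (measurableEmbedding_addRight _) f]
  congr 2
  ext x
  simp [mem_cell, cellIndex_add_dyadicVector]

variable {f u : Space d → ℝ}

theorem sum_abs_setIntegral_cell_le (n : ℕ) (s : Finset (Fin d → ℤ)) (hf : Integrable f) :
    ∑ c ∈ s, |∫ x in cell n c, f x| ≤ ∫ x, |f x| := by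
  calc ∑ c ∈ s, |∫ x in cell n c, f x| ≤ ∑ c ∈ s, ∫ x in cell n c, |f x| :=
        Finset.sum_le_sum fun c _ => abs_integral_le_integral_abs
    _ = ∫ x in ⋃ c ∈ s, cell n c, |f x| :=
        (integral_biUnion_finset s (fun c _ => measurableSet_cell n c)
          (fun c _ c' _ h => disjoint_cell h) (fun c _ => hf.abs.integrableOn)).symm
    _ ≤ ∫ x, |f x| :=
        setIntegral_le_integral hf.abs (Eventually.of_forall fun x => abs_nonneg _)

theorem MemBV.sum_abs_setIntegral_cell_add_sub_le (hu : MemBV u) (n : ℕ) (e : Fin d → ℤ)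
    (s : Finset (Fin d → ℤ)) :
    ∑ c ∈ s, |(∫ x in cell n (c + e), u x) - ∫ x in cell n c, u x| ≤
      d * ((∑ i, |(e i : ℝ)|) * ((2 : ℝ) ^ n)⁻¹) * (variation u).toReal := by
  have hsub (c : Fin d → ℤ) : (∫ x in cell n (c + e), u x) - ∫ x in cell n c, u x =
      ∫ x in cell n c, (u (x + dyadicVector n e) - u x) := by
    rw [setIntegral_cell_add, integral_sub (hu.integrable.comp_add_right _).integrableOn
      hu.integrable.integrableOn]
  simp only [hsub]
  calc ∑ c ∈ s, |∫ x in cell n c, (u (x + dyadicVector n e) - u x)|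
      ≤ ∫ x, |u (x + dyadicVector n e) - u x| :=
        sum_abs_setIntegral_cell_le n s (integrable_translate_sub hu.integrable _)
    _ ≤ d * ‖dyadicVector n e‖ * (variation u).toReal := hu.integral_abs_translate_sub_le _
    _ ≤ d * ((∑ i, |(e i : ℝ)|) * ((2 : ℝ) ^ n)⁻¹) * (variation u).toReal := by
        gcongr
        exact norm_dyadicVector_le n e

theorem MemBV.setAverage_cell_eq_zero (hu : MemBV u) (n : ℕ)
    (hc : ¬ ∀ i, 0 ≤ c i ∧ c i < 2 ^ n) : ⨍ x in cell n c, u x = 0 := by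
  rw [setAverage_cell, integral_eq_zero_of_ae, mul_zero]
  filter_upwards [ae_restrict_of_ae hu.ae_eq_zero,
    ae_restrict_of_ae (unitCube_ae_eq_cell d).mem_iff,
    ae_restrict_mem (measurableSet_cell n c)] with x hzero hcube hx
  exact hzero fun hmem => hc fun i => hx ▸ cellIndex_mem_of_mem_cell_zero (hcube.1 hmem) n i

theorem integral_comp_cellIndex_mul (n : ℕ) {a : (Fin d → ℤ) → ℝ} (ha : a.support.Finite)
    (hf : Integrable f) :
    ∫ x, a (cellIndex n x) * f x = ∑ᶠ c, a c * ∫ x in cell n c, f x := by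
  have hpointwise (x : Space d) : a (cellIndex n x) * f x =
      ∑ c ∈ ha.toFinset, a c * (cell n c).indicator f x := by
    rw [Finset.sum_eq_single (cellIndex n x)]
    · rw [Set.indicator_of_mem (mem_cell.2 rfl)]
    · intro c _ hc
      rw [Set.indicator_of_notMem (mt mem_cell.1 hc.symm), mul_zero]
    · intro hx
      simp only [Set.Finite.mem_toFinset, Function.mem_support, not_not] at hx
      rw [hx, zero_mul]
  simp only [hpointwise]
  rw [integral_finsetSum _ fun c _ => (hf.indicator (measurableSet_cell n c)).const_mul _,
    finsum_eq_sum_of_support_subset _ (s := ha.toFinset)]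
  · simp only [integral_const_mul, integral_indicator (measurableSet_cell n _)]
  · rw [Set.Finite.coe_toFinset]
    exact Function.support_mul_subset_left _ _

end cell

section variation

theorem finsum_mul_translate_sub {G R : Type*} [AddGroup G] [Ring R] {a : G → R}
    (ha : a.support.Finite) (F : G → R) (e : G) :
    ∑ᶠ c, a c * (F (c + e) - F c) = ∑ᶠ c, (a (c - e) - a c) * F c := by
  have hshift : (fun c => a (c - e)).support.Finite :=
    ha.preimage (sub_left_injective (b := e)).injOn
  have hfin {b : G → R} (hb : b.support.Finite) (H : G → R) :
      (fun c => b c * H c).support.Finite := hb.subset (Function.support_mul_subset_left _ _)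
  simp only [mul_sub, sub_mul]
  rw [finsum_sub_distrib (hfin ha _) (hfin ha _), finsum_sub_distrib (hfin hshift _) (hfin ha _),
    ← finsum_comp_equiv (Equiv.subRight e)]
  simp only [Equiv.subRight_apply, sub_add_cancel]

theorem finsum_mul_le_of_abs_le {ι : Type*} {b F : ι → ℝ} {κ B : ℝ} (hb : b.support.Finite)
    (hF : ∀ c, |F c| ≤ κ) (hB : ∀ s : Finset ι, ∑ c ∈ s, |b c| ≤ B) (hκ : 0 ≤ κ) :
    ∑ᶠ c, b c * F c ≤ B * κ := by
  rw [finsum_eq_sum_of_support_subset _ (s := hb.toFinset)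
    (by rw [hb.coe_toFinset]; exact Function.support_mul_subset_left _ _)]
  calc ∑ c ∈ hb.toFinset, b c * F c ≤ ∑ c ∈ hb.toFinset, |b c| * κ :=
        Finset.sum_le_sum fun c _ => (le_abs_self _).trans
          ((abs_mul _ _).trans_le (mul_le_mul_of_nonneg_left (hF c) (abs_nonneg _)))
    _ ≤ B * κ := by
        rw [← Finset.sum_mul]
        exact mul_le_mul_of_nonneg_right (hB _) hκ

variable {d : ℕ} {u : Space d → ℝ} {v : Space d → Space d}

-- `F i c` is the flux through the lower face orthogonal to the direction `i` of the cube of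
-- index `c`; the upper face is the lower face of the next cube.
theorem IsTestField.exists_flux (hv : IsTestField v) (n : ℕ) :
    ∃ F : Fin d → (Fin d → ℤ) → ℝ, (∀ i c, |F i c| ≤ (((2 : ℝ) ^ n)⁻¹) ^ (d - 1)) ∧
      ∀ c, ∫ x in cell n c, divergence v x = ∑ i, (F i (c + Pi.single i 1) - F i c) := by
  rcases d with _ | m
  · exact ⟨fun i => i.elim0, fun i => i.elim0, fun c => by simp [divergence]⟩
  let lo (c : Fin (m + 1) → ℤ) (i : Fin (m + 1)) : ℝ := c i / 2 ^ n
  let hi (c : Fin (m + 1) → ℤ) (i : Fin (m + 1)) : ℝ := (c i + 1) / 2 ^ n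
  have hside (c : Fin (m + 1) → ℤ) (i : Fin (m + 1)) : hi c i - lo c i = ((2 : ℝ) ^ n)⁻¹ := by
    simp only [hi, lo]
    ring
  have hlohi (c : Fin (m + 1) → ℤ) : lo c ≤ hi c := fun i =>
    sub_nonneg.1 (by rw [hside]; positivity)
  refine ⟨fun i c => boxFlux v (lo c) (hi c) i (lo c i), fun i c => ?_, fun c => ?_⟩
  · simpa [hside] using abs_boxFlux_le hv.norm_le_one (hlohi c) i (lo c i)
  · rw [setIntegral_congr_set (cell_ae_eq_closedCell n c), closedCell,
      setIntegral_box_divergence hv.contDiff (hlohi c)]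
    refine Finset.sum_congr rfl fun i _ => ?_
    have hface : lo (c + Pi.single i 1) ∘ i.succAbove = lo c ∘ i.succAbove ∧
        hi (c + Pi.single i 1) ∘ i.succAbove = hi c ∘ i.succAbove := by
      constructor <;> funext j <;> simp [lo, hi, Fin.succAbove_ne]
    have hupper : lo (c + Pi.single i 1) i = hi c i := by simp [lo, hi]
    simp only [boxFlux, hface, hupper]

theorem IsTestField.abs_setIntegral_cell_divergence_le (hv : IsTestField v) (n : ℕ)
    (c : Fin d → ℤ) :
    |∫ x in cell n c, divergence v x| ≤ 2 * d * (((2 : ℝ) ^ n)⁻¹) ^ (d - 1) := by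
  obtain ⟨F, hF, hflux⟩ := hv.exists_flux n
  rw [hflux c]
  calc |∑ i, (F i (c + Pi.single i 1) - F i c)|
      ≤ ∑ _i : Fin d, 2 * (((2 : ℝ) ^ n)⁻¹) ^ (d - 1) := by
        refine (Finset.abs_sum_le_sum_abs _ _).trans (Finset.sum_le_sum fun i _ => ?_)
        refine (abs_sub _ _).trans ?_
        linarith [hF i (c + Pi.single i 1), hF i c]
    _ = _ := by simp; ring

theorem variation_le_ofReal {B : ℝ} (h : ∀ v, IsTestField v → ∫ x, u x * divergence v x ≤ B) :
    variation u ≤ ENNReal.ofReal B :=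
  iSup₂_le fun v hv => ENNReal.ofReal_le_ofReal (h v hv)

theorem variation_comp_cellIndex_le (n : ℕ) {a : (Fin d → ℤ) → ℝ} (ha : a.support.Finite) {B : ℝ}
    (hB : ∀ i (s : Finset (Fin d → ℤ)), ∑ c ∈ s, |a (c - Pi.single i 1) - a c| ≤ B) :
    variation (fun x => a (cellIndex n x)) ≤
      ENNReal.ofReal (d * (B * (((2 : ℝ) ^ n)⁻¹) ^ (d - 1))) := by
  refine variation_le_ofReal fun v hv => ?_
  obtain ⟨F, hF, hflux⟩ := hv.exists_flux n
  have hfin (i : Fin d) : (fun c => a (c - Pi.single i 1) - a c).support.Finite :=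
    ((ha.preimage (sub_left_injective (b := Pi.single i 1)).injOn).union ha).subset
      (Function.support_sub _ _)
  calc ∫ x, a (cellIndex n x) * divergence v x
      = ∑ᶠ c, ∑ i, a c * (F i (c + Pi.single i 1) - F i c) := by
        rw [integral_comp_cellIndex_mul n ha
          (hv.continuous_divergence.integrable_of_hasCompactSupport
            hv.hasCompactSupport_divergence)]
        simp only [hflux, Finset.mul_sum]
    _ = ∑ i, ∑ᶠ c, (a (c - Pi.single i 1) - a c) * F i c := by
        rw [finsum_sum_comm _ _ fun i _ => ha.subset (Function.support_mul_subset_left _ _)]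
        simp only [finsum_mul_translate_sub ha]
    _ ≤ ∑ _i : Fin d, B * (((2 : ℝ) ^ n)⁻¹) ^ (d - 1) :=
        Finset.sum_le_sum fun i _ =>
          finsum_mul_le_of_abs_le (hfin i) (hF i) (hB i) (by positivity)
    _ = d * (B * (((2 : ℝ) ^ n)⁻¹) ^ (d - 1)) := by simp

/-- The conditional expectation of `u` with respect to the dyadic cells of generation `n`. -/
noncomputable def cellAverage (n : ℕ) (u : Space d → ℝ) (x : Space d) : ℝ :=
  ⨍ y in cell n (cellIndex n x), u y

theorem MemBV.finite_support_setAverage_cell (hu : MemBV u) (n : ℕ) :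
    (fun c => ⨍ x in cell n c, u x).support.Finite := by
  refine (Set.finite_Icc (0 : Fin d → ℤ) fun _ => 2 ^ n).subset fun c hc => ?_
  have h := not_imp_comm.1 (hu.setAverage_cell_eq_zero n) hc
  exact ⟨fun i => (h i).1, fun i => (h i).2.le⟩

-- The `L¹` modulus of continuity `d 2⁻ⁿ ‖Du‖` and the area `2^{-n(d-1)}` of a face combine to
-- exactly the volume of a cell, so the bound does not depend on `n`.
theorem MemBV.variation_cellAverage_le [NeZero d] (hu : MemBV u) (n : ℕ) :
    variation (cellAverage n u) ≤ ENNReal.ofReal (d * d * (variation u).toReal) := by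
  have hjump (i : Fin d) (s : Finset (Fin d → ℤ)) :
      ∑ c ∈ s, |(⨍ x in cell n (c - Pi.single i 1), u x) - ⨍ x in cell n c, u x| ≤
        2 ^ (n * d) * (d * ((2 : ℝ) ^ n)⁻¹ * (variation u).toReal) := by
    simp only [setAverage_cell, ← mul_sub, abs_mul, ← Finset.mul_sum]
    rw [abs_of_pos (by positivity)]
    gcongr
    simpa [sub_eq_add_neg, Pi.single_apply, apply_ite] using
      hu.sum_abs_setIntegral_cell_add_sub_le n (-Pi.single i 1) s
  have hvolume : (2 : ℝ) ^ (n * d) * (((2 : ℝ) ^ n)⁻¹ * (((2 : ℝ) ^ n)⁻¹) ^ (d - 1)) = 1 := by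
    rw [← pow_succ', Nat.sub_add_cancel (NeZero.pos d), inv_pow, pow_mul,
      mul_inv_cancel₀ (by positivity)]
  refine (variation_comp_cellIndex_le n (hu.finite_support_setAverage_cell n) hjump).trans_eq
    (congrArg ENNReal.ofReal ?_)
  linear_combination d * d * (variation u).toReal * hvolume

end variation

section matrix

theorem haarMatrix_isSymm (d : ℕ) : (haarMatrix d).IsSymm := by
  unfold Matrix.IsSymm
  induction d with
  | zero => simp [haarMatrix]
  | succ d ih =>
    simp only [haarMatrix, Matrix.transpose_reindex, Matrix.fromBlocks_transpose,
      Matrix.transpose_neg, ih]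

theorem haarMatrix_mul_self (d : ℕ) : haarMatrix d * haarMatrix d = (2 : ℝ) ^ d • 1 := by
  induction d with
  | zero => simp [haarMatrix]
  | succ d ih =>
    have hdouble : (2 : ℝ) ^ d • (1 : Matrix (Fin (2 ^ d)) (Fin (2 ^ d)) ℝ) + (2 : ℝ) ^ d • 1 =
        (2 : ℝ) ^ (d + 1) • 1 := by
      rw [← add_smul, ← mul_two, ← pow_succ]
    have hblocks : Matrix.fromBlocks
        ((2 : ℝ) ^ (d + 1) • (1 : Matrix (Fin (2 ^ d)) (Fin (2 ^ d)) ℝ)) 0 0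
        ((2 : ℝ) ^ (d + 1) • (1 : Matrix (Fin (2 ^ d)) (Fin (2 ^ d)) ℝ)) =
        (2 : ℝ) ^ (d + 1) • 1 := by
      rw [← Matrix.fromBlocks_one, Matrix.fromBlocks_smul, smul_zero]
    simp only [haarMatrix, Matrix.reindex_apply, Matrix.submatrix_mul_equiv,
      Matrix.fromBlocks_multiply, Matrix.mul_neg, Matrix.neg_mul, neg_neg, ih, hdouble,
      add_neg_cancel]
    rw [hblocks, Matrix.submatrix_smul, Pi.smul_apply, Pi.smul_apply, Matrix.submatrix_one_equiv]

theorem abs_haarMatrix (d : ℕ) (r l : Fin (2 ^ d)) : |haarMatrix d r l| = 1 := by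
  induction d with
  | zero =>
    obtain rfl : r = l := Subsingleton.elim (α := Fin 1) r l
    exact (congrArg abs (Matrix.one_apply_eq r)).trans abs_one
  | succ d ih =>
    simp only [haarMatrix, Matrix.reindex_apply, Matrix.submatrix_apply]
    generalize Equiv.symm _ r = a
    generalize Equiv.symm _ l = b
    rcases a with a | a <;> rcases b with b | b <;> simp [ih]

theorem haarMatrix_zero_left (d : ℕ) (l : Fin (2 ^ d)) : haarMatrix d 0 l = 1 := by
  induction d with
  | zero =>
    obtain rfl : l = 0 := Subsingleton.elim (α := Fin 1) l 0
    exact Matrix.one_apply_eq _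
  | succ d ih =>
    have hzero : (finSumFinEquiv.trans (finCongr (by rw [pow_succ, mul_two] :
        2 ^ d + 2 ^ d = 2 ^ (d + 1)))).symm 0 = Sum.inl 0 := by
      rw [Equiv.symm_apply_eq]
      exact Fin.ext (by simp)
    simp only [haarMatrix, Matrix.reindex_apply, Matrix.submatrix_apply]
    rw [hzero]
    generalize Equiv.symm _ l = b
    rcases b with b | b <;> simp [ih]

theorem sum_haarMatrix_mul_row (d : ℕ) (r r' : Fin (2 ^ d)) :
    ∑ l, haarMatrix d r l * haarMatrix d r' l = if r = r' then 2 ^ d else 0 := by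
  have h := congrFun (congrFun (haarMatrix_mul_self d) r) r'
  rw [Matrix.mul_apply] at h
  simpa [(haarMatrix_isSymm d).apply r', Matrix.one_apply] using h

theorem sum_haarMatrix_mul_col (d : ℕ) (l l' : Fin (2 ^ d)) :
    ∑ r, haarMatrix d r l * haarMatrix d r l' = if l = l' then 2 ^ d else 0 := by
  rw [← sum_haarMatrix_mul_row d l l']
  simp only [fun r => (haarMatrix_isSymm d).apply r l, fun r => (haarMatrix_isSymm d).apply r l']

theorem sum_haarMatrix_row (d : ℕ) {r : Fin (2 ^ d)} (hr : r ≠ 0) :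
    ∑ l, haarMatrix d r l = 0 := by
  simpa [haarMatrix_zero_left, hr] using sum_haarMatrix_mul_row d r 0

end matrix

section index

variable {d : ℕ}

theorem cellIndex_add_div (n p : ℕ) (x : Space d) (i : Fin d) :
    cellIndex (n + p) x i / 2 ^ p = cellIndex n x i := by
  have h := Int.natCast_mul_floor_div_cancel (n := 2 ^ p) (by positivity) (2 ^ n * x i)
  push_cast at h
  rw [← mul_assoc, ← pow_add, add_comm] at h
  exact h

theorem cellIndex_succ_div_two (n : ℕ) (x : Space d) (i : Fin d) :
    cellIndex (n + 1) x i / 2 = cellIndex n x i := by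
  simpa using cellIndex_add_div n 1 x i

theorem mem_cell_zero_of_cellIndex_mem {n : ℕ} {x : Space d}
    (hx : ∀ i, 0 ≤ cellIndex n x i ∧ cellIndex n x i < 2 ^ n) : x ∈ cell 0 0 := by
  refine funext fun i => ?_
  rw [← cellIndex_add_div 0 n, zero_add, Int.ediv_eq_zero_of_lt (hx i).1 (hx i).2, Pi.zero_apply]

theorem box_subset_box_iff {a b a' b' : Fin d → ℝ} (hab : a ≤ b) :
    box a b ⊆ box a' b' ↔ a' ≤ a ∧ b ≤ b' := by
  constructor
  · intro h
    have ha := h (show WithLp.toLp 2 a ∈ box a b from fun i => ⟨le_rfl, hab i⟩)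
    have hb := h (show WithLp.toLp 2 b ∈ box a b from fun i => ⟨hab i, le_rfl⟩)
    exact ⟨fun i => (ha i).1, fun i => (hb i).2⟩
  · exact fun h x hx i => ⟨(h.1 i).trans (hx i).1, (hx i).2.trans (h.2 i)⟩

theorem closedCell_subset_iff {n n' : ℕ} {c c' : Fin d → ℤ} :
    closedCell n' c' ⊆ closedCell n c ↔
      ∀ i, (c i : ℝ) / 2 ^ n ≤ c' i / 2 ^ n' ∧ ((c' i : ℝ) + 1) / 2 ^ n' ≤ (c i + 1) / 2 ^ n := by
  unfold closedCell
  rw [box_subset_box_iff fun i => by dsimp only; gcongr; linarith, Pi.le_def, Pi.le_def,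
    ← forall_and]

theorem closedCell_injective (n : ℕ) : Function.Injective (closedCell (d := d) n) := by
  intro c c' h
  have hpow : (0 : ℝ) < 2 ^ n := by positivity
  funext i
  have hle := (closedCell_subset_iff.1 h.subset i).1
  have hge := (closedCell_subset_iff.1 h.superset i).1
  rw [div_le_div_iff_of_pos_right hpow] at hle hge
  exact_mod_cast le_antisymm hge hle

theorem closedCell_succ_subset_iff {n : ℕ} {c c' : Fin d → ℤ} :
    closedCell (n + 1) c' ⊆ closedCell n c ↔ ∀ i, c' i / 2 = c i := by
  rw [closedCell_subset_iff]
  refine forall_congr' fun i => ?_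
  have hpow : (0 : ℝ) < 2 ^ (n + 1) := by positivity
  have hlo : (c i : ℝ) / 2 ^ n = (2 * c i : ℤ) / 2 ^ (n + 1) := by
    push_cast
    rw [pow_succ']
    exact (mul_div_mul_left _ _ two_ne_zero).symm
  have hhi : ((c i : ℝ) + 1) / 2 ^ n = (2 * (c i + 1) : ℤ) / 2 ^ (n + 1) := by
    push_cast
    rw [pow_succ']
    exact (mul_div_mul_left _ _ two_ne_zero).symm
  rw [hlo, hhi, div_le_div_iff_of_pos_right hpow, div_le_div_iff_of_pos_right hpow]
  norm_cast
  omega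

theorem isDyadicCube_iff {n : ℕ} {Q : Set (Space d)} :
    IsDyadicCube n Q ↔ ∃ c : Fin d → ℤ, (∀ i, 0 ≤ c i ∧ c i < 2 ^ n) ∧ Q = closedCell n c := by
  constructor
  · rintro ⟨c, hc, rfl⟩
    refine ⟨fun i => c i, fun i => ⟨Int.natCast_nonneg _, ?_⟩, by simp [closedCell]⟩
    beta_reduce
    exact_mod_cast hc i
  · rintro ⟨c, hc, rfl⟩
    lift c to Fin d → ℕ using fun i => (hc i).1
    exact ⟨c, fun i => by exact_mod_cast show (c i : ℤ) < 2 ^ n from (hc i).2, by simp [closedCell]⟩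

namespace DyadicNumbering

variable (K : DyadicNumbering d) {n k : ℕ}

/-- The index of the dyadic cube `K_{n,k}`; the value is arbitrary if `k ≥ 2^{nd}`. -/
noncomputable def index (n k : ℕ) : Fin d → ℤ :=
  Function.invFun (closedCell n) (K.cube n k)

theorem index_spec (hk : k < 2 ^ (n * d)) :
    (∀ i, 0 ≤ K.index n k i ∧ K.index n k i < 2 ^ n) ∧ K.cube n k = closedCell n (K.index n k) := by
  obtain ⟨c, hc, hcube⟩ := isDyadicCube_iff.1 ((K.bijOn n).mapsTo hk)
  have hindex : K.index n k = c := by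
    rw [index, hcube, Function.leftInverse_invFun (closedCell_injective n) c]
  exact hindex ▸ ⟨hc, hcube⟩

theorem index_injOn (n : ℕ) : Set.InjOn (K.index n) (Set.Iio (2 ^ (n * d))) :=
  fun k hk k' hk' h => (K.bijOn n).injOn hk hk' <| by
    rw [(K.index_spec hk).2, (K.index_spec hk').2, h]

theorem exists_index_eq {c : Fin d → ℤ} (hc : ∀ i, 0 ≤ c i ∧ c i < 2 ^ n) :
    ∃ k < 2 ^ (n * d), K.index n k = c := by
  obtain ⟨k, hk, hcube⟩ := (K.bijOn n).surjOn (isDyadicCube_iff.2 ⟨c, hc, rfl⟩)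
  exact ⟨k, hk, closedCell_injective n (by rw [← (K.index_spec hk).2, hcube])⟩

/-- The index of `K_{n+1, 2^d k + l}`, the `l`-th child of `K_{n,k}`. -/
noncomputable def child (n k : ℕ) (l : Fin (2 ^ d)) : Fin d → ℤ :=
  K.index (n + 1) (2 ^ d * k + l)

theorem child_lt (hk : k < 2 ^ (n * d)) (l : Fin (2 ^ d)) :
    2 ^ d * k + l < 2 ^ ((n + 1) * d) :=
  calc 2 ^ d * k + l < 2 ^ d * k + 2 ^ d := by have := l.2; omega
    _ = 2 ^ d * (k + 1) := by ring
    _ ≤ 2 ^ d * 2 ^ (n * d) := Nat.mul_le_mul_left _ hk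
    _ = 2 ^ ((n + 1) * d) := by ring

theorem cube_child (hk : k < 2 ^ (n * d)) (l : Fin (2 ^ d)) :
    K.cube (n + 1) (2 ^ d * k + l) = closedCell (n + 1) (K.child n k l) :=
  (K.index_spec (child_lt hk l)).2

theorem child_div_two (hk : k < 2 ^ (n * d)) (l : Fin (2 ^ d)) (i : Fin d) :
    K.child n k l i / 2 = K.index n k i := by
  have h := ((K.image_children n k hk).subset ⟨l, l.2, rfl⟩).2
  dsimp only at h
  rw [K.cube_child hk, (K.index_spec hk).2] at h
  exact closedCell_succ_subset_iff.1 h i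

theorem child_injective (hk : k < 2 ^ (n * d)) : Function.Injective (K.child n k) :=
  fun l l' h => Fin.ext <| Nat.add_left_cancel <|
    K.index_injOn (n + 1) (child_lt hk l) (child_lt hk l') h

theorem exists_child_eq (hk : k < 2 ^ (n * d)) {c : Fin d → ℤ}
    (hc : ∀ i, c i / 2 = K.index n k i) : ∃ l, K.child n k l = c := by
  have hrange (i : Fin d) : 0 ≤ c i ∧ c i < 2 ^ (n + 1) := by
    have := (K.index_spec hk).1 i
    have := hc i
    rw [pow_succ]
    omega
  have hmem : closedCell (n + 1) c ∈ {Q | IsDyadicCube (n + 1) Q ∧ Q ⊆ K.cube n k} :=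
    ⟨isDyadicCube_iff.2 ⟨c, hrange, rfl⟩, by
      rw [(K.index_spec hk).2]
      exact closedCell_succ_subset_iff.2 hc⟩
  rw [← K.image_children n k hk] at hmem
  obtain ⟨l, hl, hcube⟩ := hmem
  exact ⟨⟨l, hl⟩, closedCell_injective (n + 1) ((K.cube_child hk ⟨l, hl⟩).symm.trans hcube)⟩

theorem cell_index_eq_iUnion_child (hk : k < 2 ^ (n * d)) :
    cell n (K.index n k) = ⋃ l, cell (n + 1) (K.child n k l) := by
  ext x
  simp only [Set.mem_iUnion, mem_cell]
  constructor
  · intro hx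
    obtain ⟨l, hl⟩ := K.exists_child_eq hk (c := cellIndex (n + 1) x) fun i => by
      rw [cellIndex_succ_div_two, hx]
    exact ⟨l, hl.symm⟩
  · rintro ⟨l, hl⟩
    funext i
    rw [← cellIndex_succ_div_two, hl, K.child_div_two hk]

theorem setIntegral_cell_index_eq_sum_child {f : Space d → ℝ} (hf : Integrable f)
    (hk : k < 2 ^ (n * d)) :
    ∫ x in cell n (K.index n k), f x = ∑ l, ∫ x in cell (n + 1) (K.child n k l), f x := by
  rw [K.cell_index_eq_iUnion_child hk, integral_iUnion_fintype (fun l => measurableSet_cell _ _)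
    (fun l l' h => disjoint_cell ((K.child_injective hk).ne h)) fun l => hf.integrableOn]

end DyadicNumbering

end index

section haarValue

variable {d : ℕ} {f : Space d → ℝ}

theorem ae_mem_closedCell_iff :
    ∀ᵐ x : Space d, ∀ (n : ℕ) (c : Fin d → ℤ), x ∈ closedCell n c ↔ x ∈ cell n c :=
  ae_all_iff.2 fun n => ae_all_iff.2 fun c => (cell_ae_eq_closedCell n c).symm.mem_iff

/-- The normalizing factor of the Haar functions of generation `n`. -/
noncomputable def haarScale (d n : ℕ) : ℝ := 2 ^ ((n * d : ℝ) / 2)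

theorem haarScale_pos (d n : ℕ) : 0 < haarScale d n :=
  Real.rpow_pos_of_pos two_pos _

theorem haarScale_mul_self (d n : ℕ) : haarScale d n * haarScale d n = 2 ^ (n * d) := by
  rw [haarScale, ← Real.rpow_add two_pos, add_halves]
  exact_mod_cast Real.rpow_natCast 2 (n * d)

theorem haarScale_mul_self_mul_volume (d n : ℕ) :
    haarScale d n * haarScale d n * (((2 : ℝ) ^ (n + 1))⁻¹) ^ d * 2 ^ d = 1 := by
  rw [haarScale_mul_self, mul_right_comm, ← pow_add, inv_pow, ← pow_mul, add_mul, one_mul]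
  exact mul_inv_cancel₀ (by positivity)

variable (K : DyadicNumbering d) {n k k' : ℕ}

/-- The value of `g_{n,k,r}` in the interior of the dyadic cube of side `2⁻⁽ⁿ⁺¹⁾` with index `c`. -/
noncomputable def haarValue (n k : ℕ) (r : Fin (2 ^ d)) (c : Fin d → ℤ) : ℝ :=
  haarScale d n * ∑ l, haarMatrix d r l * if c = K.child n k l then 1 else 0

theorem ae_haar_eq : ∀ᵐ x : Space d, ∀ n, ∀ k < 2 ^ (n * d), ∀ r,
    haar K n k r x = haarValue K n k r (cellIndex (n + 1) x) := by
  filter_upwards [ae_mem_closedCell_iff] with x hx n k hk r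
  simp only [haar, haarValue, haarScale, Set.indicator, K.cube_child hk, hx, mem_cell]

theorem haarValue_child (hk : k < 2 ^ (n * d)) (r l : Fin (2 ^ d)) :
    haarValue K n k r (K.child n k l) = haarScale d n * haarMatrix d r l := by
  simp [haarValue, (K.child_injective hk).eq_iff]

theorem haarValue_eq_zero (hk : k < 2 ^ (n * d)) (r : Fin (2 ^ d)) {c : Fin d → ℤ}
    (hc : (fun i => c i / 2) ≠ K.index n k) : haarValue K n k r c = 0 := by
  have hne (l : Fin (2 ^ d)) : c ≠ K.child n k l := by
    rintro rfl
    exact hc (funext (K.child_div_two hk l))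
  simp [haarValue, hne]

theorem haarValue_child_of_ne (hk : k < 2 ^ (n * d)) (hk' : k' < 2 ^ (n * d)) (h : k ≠ k')
    (r l : Fin (2 ^ d)) : haarValue K n k r (K.child n k' l) = 0 :=
  haarValue_eq_zero K hk r fun hc =>
    h (K.index_injOn n hk hk' (hc.symm.trans (funext (K.child_div_two hk' l))))

theorem integral_mul_haar (hf : Integrable f) (hk : k < 2 ^ (n * d)) (r : Fin (2 ^ d)) :
    ∫ x, f x * haar K n k r x =
      haarScale d n * ∑ l, haarMatrix d r l * ∫ x in cell (n + 1) (K.child n k l), f x := by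
  have hpointwise : ∀ᵐ x, f x * haar K n k r x = haarScale d n *
      ∑ l, haarMatrix d r l * (cell (n + 1) (K.child n k l)).indicator f x := by
    filter_upwards [ae_haar_eq K] with x hx
    rw [hx n k hk, haarValue, mul_left_comm, Finset.mul_sum]
    refine congrArg _ (Finset.sum_congr rfl fun l _ => ?_)
    simp only [Set.indicator, mem_cell, mul_ite, mul_one, mul_zero]
    split_ifs <;> ring
  rw [integral_congr_ae hpointwise, integral_const_mul, integral_finsetSum]
  · simp only [integral_const_mul, integral_indicator (measurableSet_cell _ _)]
  · exact fun l _ => (hf.indicator (measurableSet_cell _ _)).const_mul _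

theorem sum_integral_mul_haar_mul (hf : Integrable f) (hk : k < 2 ^ (n * d)) (l : Fin (2 ^ d)) :
    ∑ r ∈ Finset.univ.erase 0, (∫ x, f x * haar K n k r x) * (haarScale d n * haarMatrix d r l) =
      (⨍ x in cell (n + 1) (K.child n k l), f x) - ⨍ x in cell n (K.index n k), f x := by
  have hterm (r : Fin (2 ^ d)) :
      (∫ x, f x * haar K n k r x) * (haarScale d n * haarMatrix d r l) =
        2 ^ (n * d) * ∑ l', (∫ x in cell (n + 1) (K.child n k l'), f x) *
          (haarMatrix d r l' * haarMatrix d r l) := by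
    rw [integral_mul_haar K hf hk, ← haarScale_mul_self, Finset.mul_sum, Finset.sum_mul,
      Finset.mul_sum]
    exact Finset.sum_congr rfl fun l' _ => by ring
  rw [Finset.sum_erase_eq_sub (Finset.mem_univ _)]
  simp only [hterm]
  congr 1
  · rw [← Finset.mul_sum, Finset.sum_comm, setAverage_cell, add_mul, one_mul, pow_add, mul_assoc]
    simp only [← Finset.mul_sum, sum_haarMatrix_mul_col]
    simp [mul_comm]
  · simp only [haarMatrix_zero_left, mul_one]
    rw [setAverage_cell, K.setIntegral_cell_index_eq_sum_child hf hk]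

theorem ae_sum_generation_eq (hf : Integrable f) (n : ℕ) : ∀ᵐ x, x ∈ cell 0 0 →
    ∑ k ∈ Finset.range (2 ^ (n * d)), ∑ r ∈ Finset.univ.erase 0,
      (∫ y, f y * haar K n k r y) * haar K n k r x =
        cellAverage (n + 1) f x - cellAverage n f x := by
  filter_upwards [ae_haar_eq K] with x hx hx0
  obtain ⟨k, hk, hkx⟩ := K.exists_index_eq (cellIndex_mem_of_mem_cell_zero hx0 n)
  obtain ⟨l, hl⟩ := K.exists_child_eq hk (c := cellIndex (n + 1) x) fun i => by
    rw [cellIndex_succ_div_two, hkx]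
  rw [Finset.sum_eq_single_of_mem k (Finset.mem_range.2 hk)]
  · simp only [hx n k hk, ← hl, haarValue_child K hk, sum_integral_mul_haar_mul K hf hk,
      cellAverage, hkx]
  · intro k' hk' hne
    refine Finset.sum_eq_zero fun r _ => ?_
    rw [Finset.mem_range] at hk'
    rw [hx n k' hk', ← hl, haarValue_child_of_ne K hk' hk hne, mul_zero]

theorem integral_mul_haar_eq_zero_of_const (hf : Integrable f) (hk : k < 2 ^ (n * d))
    {r : Fin (2 ^ d)} (hr : r ≠ 0) {a : ℝ}
    (ha : ∀ᵐ x, x ∈ cell n (K.index n k) → f x = a) : ∫ x, f x * haar K n k r x = 0 := by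
  have hchild (l : Fin (2 ^ d)) :
      ∫ x in cell (n + 1) (K.child n k l), f x = (((2 : ℝ) ^ (n + 1))⁻¹) ^ d * a := by
    rw [setIntegral_congr_ae (g := fun _ => a) (measurableSet_cell _ _), setIntegral_const,
      volume_real_cell, smul_eq_mul]
    filter_upwards [ha] with x hx hxl
    exact hx (by rw [K.cell_index_eq_iUnion_child hk]; exact Set.mem_iUnion.2 ⟨l, hxl⟩)
  simp only [integral_mul_haar K hf hk, hchild]
  rw [← Finset.sum_mul, sum_haarMatrix_row d hr, zero_mul, mul_zero]

theorem integrable_haar (hk : k < 2 ^ (n * d)) (r : Fin (2 ^ d)) : Integrable (haar K n k r) :=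
  (integrable_finsetSum _ fun l _ =>
    (isDyadicCube_child K hk l).memBV.integrable.const_mul _).const_mul _

theorem setIntegral_child_haar (hk : k < 2 ^ (n * d)) (r : Fin (2 ^ d)) (k' : ℕ)
    (l : Fin (2 ^ d)) :
    ∫ x in cell (n + 1) (K.child n k' l), haar K n k r x =
      (((2 : ℝ) ^ (n + 1))⁻¹) ^ d * haarValue K n k r (K.child n k' l) := by
  rw [setIntegral_congr_ae (g := fun _ => haarValue K n k r (K.child n k' l))
    (measurableSet_cell _ _), setIntegral_const, volume_real_cell, smul_eq_mul]
  filter_upwards [ae_haar_eq K] with x hx hxl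
  rw [hx n k hk, mem_cell.1 hxl]

theorem integral_haar_mul_haar (hk : k < 2 ^ (n * d)) (hk' : k' < 2 ^ (n * d))
    (r r' : Fin (2 ^ d)) :
    ∫ x, haar K n k r x * haar K n k' r' x = if k = k' ∧ r = r' then 1 else 0 := by
  simp only [integral_mul_haar K (integrable_haar K hk r) hk', setIntegral_child_haar K hk]
  by_cases hkk : k = k'
  · subst hkk
    calc haarScale d n * ∑ l, haarMatrix d r' l *
          ((((2 : ℝ) ^ (n + 1))⁻¹) ^ d * haarValue K n k r (K.child n k l))
        = haarScale d n * haarScale d n * (((2 : ℝ) ^ (n + 1))⁻¹) ^ d *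
            ∑ l, haarMatrix d r l * haarMatrix d r' l := by
          rw [Finset.mul_sum, Finset.mul_sum]
          refine Finset.sum_congr rfl fun l _ => ?_
          rw [haarValue_child K hk]
          ring
      _ = if k = k ∧ r = r' then 1 else 0 := by
          simp only [true_and, sum_haarMatrix_mul_row]
          split_ifs
          · exact haarScale_mul_self_mul_volume d n
          · rw [mul_zero]
  · simp [haarValue_child_of_ne K hk hk' hkk, hkk]

end haarValue

section haarIndex

variable {d : ℕ}

/-- The position of `g_{n,k,r}`, `r ≥ 1`, in the sequence `haarSeq`. -/
def haarIndex (d n k : ℕ) (r : Fin (2 ^ d)) : ℕ := 2 ^ (n * d) + k * (2 ^ d - 1) + (r - 1)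

theorem two_pow_add_two_pow_mul (d n : ℕ) :
    2 ^ (n * d) + 2 ^ (n * d) * (2 ^ d - 1) = 2 ^ ((n + 1) * d) := by
  have hpow : 1 ≤ 2 ^ d := Nat.one_le_two_pow
  rw [add_comm, ← Nat.mul_succ, Nat.succ_eq_add_one, Nat.sub_add_cancel hpow, ← pow_add, add_mul,
    one_mul]

theorem exists_generation [NeZero d] {j : ℕ} (hj : j ≠ 0) :
    ∃ n, 2 ^ (n * d) ≤ j ∧ j < 2 ^ ((n + 1) * d) := by
  have hpow : 1 < 2 ^ d := Nat.one_lt_two_pow (NeZero.ne d)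
  refine ⟨Nat.log (2 ^ d) j, ?_, ?_⟩ <;> rw [mul_comm, pow_mul]
  exacts [Nat.pow_log_le_self _ hj, Nat.lt_pow_succ_log_self hpow j]

theorem exists_haarIndex_eq [NeZero d] {n j : ℕ} (hle : 2 ^ (n * d) ≤ j)
    (hlt : j < 2 ^ ((n + 1) * d)) :
    ∃ k < 2 ^ (n * d), ∃ r, r ≠ 0 ∧ haarIndex d n k r = j := by
  have hpow : 1 < 2 ^ d := Nat.one_lt_two_pow (NeZero.ne d)
  have hmod := Nat.mod_lt (j - 2 ^ (n * d)) (Nat.sub_pos_of_lt hpow)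
  refine ⟨(j - 2 ^ (n * d)) / (2 ^ d - 1), ?_, ⟨(j - 2 ^ (n * d)) % (2 ^ d - 1) + 1, by omega⟩,
    Fin.val_ne_zero_iff.1 (Nat.succ_ne_zero _), ?_⟩
  · rw [← two_pow_add_two_pow_mul] at hlt
    exact (Nat.div_lt_iff_lt_mul (Nat.sub_pos_of_lt hpow)).2 (by omega)
  · rw [haarIndex, Nat.add_sub_cancel, add_assoc, mul_comm (_ / _), Nat.div_add_mod,
      Nat.add_sub_cancel' hle]

theorem haarSeq_haarIndex [NeZero d] (K : DyadicNumbering d) {n k : ℕ} (hk : k < 2 ^ (n * d))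
    {r : Fin (2 ^ d)} (hr : r ≠ 0) : haarSeq K (haarIndex d n k r) = haar K n k r :=
  haarSeq_index K n k hk r (Nat.one_le_iff_ne_zero.2 (Fin.val_ne_zero_iff.2 hr))

theorem sum_range_add_mul {M : Type*} [AddCommMonoid M] (F : ℕ → M) (m a b : ℕ) :
    ∑ j ∈ Finset.range (m + a * b), F j =
      ∑ j ∈ Finset.range m, F j +
        ∑ k ∈ Finset.range a, ∑ q ∈ Finset.range b, F (m + k * b + q) := by
  induction a with
  | zero => simp
  | succ a ih =>
    rw [Finset.sum_range_succ, ← add_assoc, ← ih, ← Finset.sum_range_add, add_mul, one_mul,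
      add_assoc]

theorem sum_univ_erase_zero {M : Type*} [AddCommMonoid M] (m : ℕ) [NeZero m] (F : ℕ → M) :
    ∑ r ∈ (Finset.univ : Finset (Fin m)).erase 0, F (r - 1) = ∑ q ∈ Finset.range (m - 1), F q := by
  obtain ⟨m, rfl⟩ := Nat.exists_eq_succ_of_ne_zero (NeZero.ne m)
  rw [Fin.univ_succ, Finset.erase_cons, Finset.sum_map]
  exact Fin.sum_univ_eq_sum_range F m

theorem sum_range_generation {M : Type*} [AddCommMonoid M] (F : ℕ → M) (n : ℕ) :
    ∑ j ∈ Finset.range (2 ^ ((n + 1) * d)), F j = ∑ j ∈ Finset.range (2 ^ (n * d)), F j +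
      ∑ k ∈ Finset.range (2 ^ (n * d)), ∑ r ∈ Finset.univ.erase 0, F (haarIndex d n k r) := by
  rw [← two_pow_add_two_pow_mul, sum_range_add_mul]
  refine congrArg _ (Finset.sum_congr rfl fun k _ => ?_)
  exact (sum_univ_erase_zero (2 ^ d) fun q => F (2 ^ (n * d) + k * (2 ^ d - 1) + q)).symm

end haarIndex

section haarSeq

variable {d : ℕ} [NeZero d] (K : DyadicNumbering d) {f : Space d → ℝ}

theorem integral_mul_haarSeq_zero (f : Space d → ℝ) :
    ∫ x, f x * haarSeq K 0 x = ∫ x in cell 0 0, f x := by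
  rw [← setIntegral_congr_set (unitCube_ae_eq_cell d),
    ← integral_indicator (isCompact_unitCube d).measurableSet]
  refine integral_congr_ae (Eventually.of_forall fun x => ?_)
  by_cases hx : x ∈ unitCube d <;> simp [haarSeq, hx]

theorem ae_sum_haarSeq_eq (hf : Integrable f) (n : ℕ) : ∀ᵐ x, x ∈ cell 0 0 →
    ∑ j ∈ Finset.range (2 ^ (n * d)), (∫ y, f y * haarSeq K j y) * haarSeq K j x =
      cellAverage n f x := by
  induction n with
  | zero =>
    filter_upwards [(unitCube_ae_eq_cell d).mem_iff] with x hx hx0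
    simp only [zero_mul, pow_zero, Finset.sum_range_one, integral_mul_haarSeq_zero]
    simp [cellAverage, setAverage_cell, haarSeq, hx.2 hx0, mem_cell.1 hx0]
  | succ n ih =>
    filter_upwards [ih, ae_sum_generation_eq K hf n] with x hx hgen hx0
    rw [sum_range_generation, hx hx0, ← eq_sub_iff_add_eq', ← hgen hx0]
    refine Finset.sum_congr rfl fun k hk => Finset.sum_congr rfl fun r hr => ?_
    rw [haarSeq_haarIndex K (Finset.mem_range.1 hk) (Finset.ne_of_mem_erase hr)]

theorem exists_haarSeq_ae_eq {i n : ℕ} (hi : i < 2 ^ (n * d)) :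
    ∃ a : (Fin d → ℤ) → ℝ, ∀ᵐ x, haarSeq K i x = a (cellIndex n x) := by
  rcases eq_or_ne i 0 with rfl | hi0
  · classical
    refine ⟨fun c => if (fun i => c i / 2 ^ n) = 0 then 1 else 0, ?_⟩
    filter_upwards [(unitCube_ae_eq_cell d).mem_iff] with x hx
    have hindex : (fun i => cellIndex n x i / 2 ^ n) = cellIndex 0 x :=
      funext fun i => by rw [← cellIndex_add_div 0 n, zero_add]
    simp only [haarSeq, Set.indicator, hx, mem_cell, hindex]
  · obtain ⟨m, hle, hlt⟩ := exists_generation (d := d) hi0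
    obtain ⟨k, hk, r, hr, rfl⟩ := exists_haarIndex_eq hle hlt
    have hmn : m < n := (Nat.mul_lt_mul_right (NeZero.pos d)).1
      ((Nat.pow_lt_pow_iff_right one_lt_two).1 (hle.trans_lt hi))
    obtain ⟨p, rfl⟩ := Nat.exists_eq_add_of_le hmn
    refine ⟨fun c => haarValue K m k r fun i => c i / 2 ^ p, ?_⟩
    filter_upwards [ae_haar_eq K] with x hx
    simp only [haarSeq_haarIndex K hk hr, hx m k hk, cellIndex_add_div]

theorem integral_haarSeq_mul_haar {i n k : ℕ} (hi : i < 2 ^ (n * d)) (hk : k < 2 ^ (n * d))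
    {r : Fin (2 ^ d)} (hr : r ≠ 0) : ∫ x, haarSeq K i x * haar K n k r x = 0 := by
  obtain ⟨a, ha⟩ := exists_haarSeq_ae_eq K hi
  refine integral_mul_haar_eq_zero_of_const K (memBV_haarSeq K i).integrable hk hr
    (a := a (K.index n k)) ?_
  filter_upwards [ha] with x hx hxk
  rw [hx, mem_cell.1 hxk]

theorem integral_haarSeq_mul_of_lt {i j : ℕ} (hij : i < j) :
    ∫ x, haarSeq K i x * haarSeq K j x = 0 := by
  obtain ⟨n, hle, hlt⟩ := exists_generation (d := d) (Nat.ne_zero_of_lt hij)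
  obtain ⟨k, hk, r, hr, rfl⟩ := exists_haarIndex_eq hle hlt
  rw [haarSeq_haarIndex K hk hr]
  rcases lt_or_ge i (2 ^ (n * d)) with hi | hi
  · exact integral_haarSeq_mul_haar K hi hk hr
  · obtain ⟨k', hk', r', hr', rfl⟩ := exists_haarIndex_eq hi (hij.trans hlt)
    rw [haarSeq_haarIndex K hk' hr', integral_haar_mul_haar K hk' hk, if_neg]
    rintro ⟨rfl, rfl⟩
    exact hij.false

theorem integral_haarSeq_mul_self (j : ℕ) : ∫ x, haarSeq K j x * haarSeq K j x = 1 := by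
  rcases eq_or_ne j 0 with rfl | hj
  · have hone : ∀ᵐ x, x ∈ cell 0 0 → haarSeq K 0 x = 1 := by
      filter_upwards [(unitCube_ae_eq_cell d).mem_iff] with x hx hx0
      exact Set.indicator_of_mem (hx.2 hx0) fun _ => (1 : ℝ)
    rw [integral_mul_haarSeq_zero, setIntegral_congr_ae (measurableSet_cell 0 0) hone,
      setIntegral_const, volume_real_cell]
    simp
  · obtain ⟨n, hle, hlt⟩ := exists_generation (d := d) hj
    obtain ⟨k, hk, r, hr, rfl⟩ := exists_haarIndex_eq hle hlt
    rw [haarSeq_haarIndex K hk hr, integral_haar_mul_haar K hk hk, if_pos ⟨rfl, rfl⟩]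

theorem integral_haarSeq_mul (i j : ℕ) :
    ∫ x, haarSeq K i x * haarSeq K j x = if i = j then 1 else 0 := by
  rcases lt_trichotomy i j with h | rfl | h
  · rw [integral_haarSeq_mul_of_lt K h, if_neg h.ne]
  · rw [integral_haarSeq_mul_self, if_pos rfl]
  · simp only [mul_comm (haarSeq K i _)]
    rw [integral_haarSeq_mul_of_lt K h, if_neg h.ne']

end haarSeq

section haarEstimates

variable {d : ℕ} (K : DyadicNumbering d) {n k : ℕ} {u : Space d → ℝ}

-- Since the row `r ≠ 0` of `A_d` sums to `0`, the integral over a reference cell, the corner cell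
-- `2 * index`, may be subtracted from the integral over each child.
theorem abs_integral_mul_haar_le (hu : Integrable u) (hk : k < 2 ^ (n * d)) {r : Fin (2 ^ d)}
    (hr : r ≠ 0) :
    |∫ x, u x * haar K n k r x| ≤ haarScale d n * ∑ e ∈ Finset.Icc (0 : Fin d → ℤ) 1,
      |(∫ x in cell (n + 1) (2 * K.index n k + e), u x) -
        ∫ x in cell (n + 1) (2 * K.index n k), u x| := by
  let I (c : Fin d → ℤ) : ℝ := ∫ x in cell (n + 1) c, u x
  let base : Fin d → ℤ := 2 * K.index n k
  have hoffset (l : Fin (2 ^ d)) : K.child n k l - base ∈ Finset.Icc (0 : Fin d → ℤ) 1 := by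
    rw [Finset.mem_Icc, Pi.le_def, Pi.le_def, ← forall_and]
    intro i
    have h := K.child_div_two hk l i
    simp only [base, Pi.sub_apply, Pi.mul_apply, Pi.ofNat_apply]
    omega
  rw [integral_mul_haar K hu hk, abs_mul, abs_of_pos (haarScale_pos d n)]
  refine mul_le_mul_of_nonneg_left ?_ (haarScale_pos d n).le
  calc |∑ l, haarMatrix d r l * I (K.child n k l)|
      = |∑ l, haarMatrix d r l * (I (base + (K.child n k l - base)) - I base)| := by
        simp only [mul_sub, Finset.sum_sub_distrib, ← Finset.sum_mul, sum_haarMatrix_row d hr,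
          zero_mul, sub_zero, add_sub_cancel]
    _ ≤ ∑ l, |I (base + (K.child n k l - base)) - I base| := by
        refine (Finset.abs_sum_le_sum_abs _ _).trans_eq ?_
        simp only [abs_mul, abs_haarMatrix, one_mul]
    _ = ∑ e ∈ Finset.univ.image fun l => K.child n k l - base, |I (base + e) - I base| := by
        rw [Finset.sum_image fun l _ l' _ h => K.child_injective hk (sub_left_inj.1 h)]
    _ ≤ ∑ e ∈ Finset.Icc (0 : Fin d → ℤ) 1, |I (base + e) - I base| :=
        Finset.sum_le_sum_of_subset_of_nonneg
          (Finset.image_subset_iff.2 fun l _ => hoffset l) fun _ _ _ => abs_nonneg _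

theorem sum_abs_integral_mul_haar_le (hu : MemBV u) (n : ℕ) {r : Fin (2 ^ d)} (hr : r ≠ 0) :
    ∑ k ∈ Finset.range (2 ^ (n * d)), |∫ x, u x * haar K n k r x| ≤
      haarScale d n * (2 ^ d * (d * (d * ((2 : ℝ) ^ (n + 1))⁻¹) * (variation u).toReal)) := by
  let J (e c : Fin d → ℤ) : ℝ := |(∫ x in cell (n + 1) (c + e), u x) - ∫ x in cell (n + 1) c, u x|
  have hinj : Set.InjOn (fun k => 2 * K.index n k) (Finset.range (2 ^ (n * d))) := by
    intro k hk k' hk' h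
    refine K.index_injOn n (Finset.mem_range.1 hk) (Finset.mem_range.1 hk') (funext fun i => ?_)
    simpa using congrFun h i
  have hcard : (Finset.Icc (0 : Fin d → ℤ) 1).card = 2 ^ d := by simp [Pi.card_Icc]
  have hnorm {e : Fin d → ℤ} (he : e ∈ Finset.Icc 0 1) : ∑ i, |(e i : ℝ)| ≤ d := by
    obtain ⟨h0, h1⟩ := Finset.mem_Icc.1 he
    refine (Finset.sum_le_card_nsmul _ _ 1 fun i _ => ?_).trans_eq (by simp)
    rw [abs_of_nonneg (by exact_mod_cast h0 i)]
    exact_mod_cast h1 i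
  calc ∑ k ∈ Finset.range (2 ^ (n * d)), |∫ x, u x * haar K n k r x|
      ≤ ∑ k ∈ Finset.range (2 ^ (n * d)),
          haarScale d n * ∑ e ∈ Finset.Icc 0 1, J e (2 * K.index n k) :=
        Finset.sum_le_sum fun k hk =>
          abs_integral_mul_haar_le K hu.integrable (Finset.mem_range.1 hk) hr
    _ = haarScale d n * ∑ e ∈ Finset.Icc 0 1,
          ∑ c ∈ (Finset.range (2 ^ (n * d))).image fun k => 2 * K.index n k, J e c := by
        rw [← Finset.mul_sum, Finset.sum_comm]
        simp only [Finset.sum_image hinj]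
    _ ≤ haarScale d n * ∑ _e ∈ Finset.Icc (0 : Fin d → ℤ) 1,
          d * (d * ((2 : ℝ) ^ (n + 1))⁻¹) * (variation u).toReal := by
        refine mul_le_mul_of_nonneg_left (Finset.sum_le_sum fun e he => ?_) (haarScale_pos d n).le
        refine (hu.sum_abs_setIntegral_cell_add_sub_le (n + 1) e _).trans ?_
        gcongr
        exact hnorm he
    _ = _ := by simp [hcard]

theorem variation_haar_le (hk : k < 2 ^ (n * d)) (r : Fin (2 ^ d)) :
    variation (haar K n k r) ≤
      ENNReal.ofReal (haarScale d n * (2 ^ d * (2 * d * (((2 : ℝ) ^ (n + 1))⁻¹) ^ (d - 1)))) := by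
  refine variation_le_ofReal fun v hv => ?_
  have hdiv : Integrable (divergence v) :=
    hv.continuous_divergence.integrable_of_hasCompactSupport hv.hasCompactSupport_divergence
  simp only [mul_comm (haar K n k r _)]
  rw [integral_mul_haar K hdiv hk]
  refine mul_le_mul_of_nonneg_left ?_ (haarScale_pos d n).le
  calc ∑ l, haarMatrix d r l * ∫ x in cell (n + 1) (K.child n k l), divergence v x
      ≤ ∑ _l : Fin (2 ^ d), 2 * d * (((2 : ℝ) ^ (n + 1))⁻¹) ^ (d - 1) := by
        refine Finset.sum_le_sum fun l _ => (le_abs_self _).trans ?_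
        rw [abs_mul, abs_haarMatrix, one_mul]
        exact hv.abs_setIntegral_cell_divergence_le (n + 1) _
    _ = _ := by simp

end haarEstimates

section haarSum

variable {d : ℕ}

theorem BV.variation_le_norm (u : BV d) : (variation u).toReal ≤ ‖u‖ := by
  rw [BV.norm_eq]
  exact le_add_of_nonneg_left (integral_nonneg fun x => abs_nonneg _)

variable [NeZero d]

theorem BV.norm_le_variation (u : BV d) : ‖u‖ ≤ (2 * d + 1) * (variation u).toReal := by
  rw [BV.norm_eq]
  linarith [u.memBV.integral_abs_le]

theorem BV.norm_le_of_variation_le (u : BV d) {B : ℝ} (hB : 0 ≤ B)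
    (h : variation u ≤ ENNReal.ofReal B) : ‖u‖ ≤ (2 * d + 1) * B :=
  u.norm_le_variation.trans <|
    mul_le_mul_of_nonneg_left (ENNReal.toReal_le_of_le_ofReal hB h) (by positivity)

variable (K : DyadicNumbering d) {n k : ℕ}

theorem T_haarLp_apply (j : ℕ) (u : BV d) : T d (haarLp K j) u = ∫ x, u x * haarSeq K j x := by
  calc ∫ x in unitCube d, haarLp K j x * u x = ∫ x in unitCube d, u x * haarSeq K j x := by
        refine integral_congr_ae ?_
        filter_upwards [(memLp_haarSeq K j).coeFn_toLp] with x hx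
        rw [haarLp, hx, mul_comm]
    _ = ∫ x, u x * haarSeq K j x := by
        refine setIntegral_eq_integral_of_ae_compl_eq_zero ?_
        filter_upwards [u.memBV.ae_eq_zero] with x hx hmem
        rw [hx hmem, zero_mul]

theorem coe_haarBV (j : ℕ) : haarBV K j =ᵐ[volume] haarSeq K j :=
  BV.coe_mk _ _

/-- The partial sum of order `N` of the Haar series, as an operator on `BV([0, 1]ᵈ)`. -/
noncomputable def haarSum (N : ℕ) : BV d →L[ℝ] BV d :=
  ∑ j ∈ Finset.range N, (T d (haarLp K j)).smulRight (haarBV K j)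

theorem haarSum_apply (N : ℕ) (u : BV d) :
    haarSum K N u = ∑ j ∈ Finset.range N, (∫ x, u x * haarSeq K j x) • haarBV K j := by
  simp [haarSum, T_haarLp_apply]

theorem coe_haarSum (N : ℕ) (u : BV d) : haarSum K N u =ᵐ[volume]
    fun x => ∑ j ∈ Finset.range N, (∫ y, u y * haarSeq K j y) * haarSeq K j x := by
  rw [haarSum_apply]
  induction N with
  | zero => exact Lp.coeFn_zero ℝ 1 volume
  | succ N ih =>
    simp only [Finset.sum_range_succ]
    filter_upwards [BV.coe_add _ _, BV.coe_smul (∫ x, u x * haarSeq K N x) (haarBV K N), ih,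
      coe_haarBV K N] with x hadd hsmul hsum hhaar
    rw [hadd, hsmul, hsum, hhaar]

theorem coe_haarSum_two_pow (n : ℕ) (u : BV d) :
    haarSum K (2 ^ (n * d)) u =ᵐ[volume] cellAverage n u := by
  filter_upwards [coe_haarSum K (2 ^ (n * d)) u, ae_sum_haarSeq_eq K u.memBV.integrable n,
    ae_all_iff.2 fun j => (memBV_haarSeq K j).ae_eq_zero,
    (unitCube_ae_eq_cell d).mem_iff] with x hsum hin hout hcube
  by_cases hx : x ∈ cell 0 0
  · rw [hsum, hin hx]
  · rw [hsum, cellAverage,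
      u.memBV.setAverage_cell_eq_zero n fun h => hx (mem_cell_zero_of_cellIndex_mem h)]
    exact Finset.sum_eq_zero fun j _ => by rw [hout j (mt hcube.1 hx), mul_zero]

theorem norm_haarSum_two_pow_le (n : ℕ) : ‖haarSum K (2 ^ (n * d))‖ ≤ (2 * d + 1) * (d * d) := by
  refine ContinuousLinearMap.opNorm_le_bound _ (by positivity) fun u => ?_
  calc ‖haarSum K (2 ^ (n * d)) u‖ ≤ (2 * d + 1) * (d * d * (variation u).toReal) := by
        refine BV.norm_le_of_variation_le _ (by positivity) ?_
        rw [variation_congr (coe_haarSum_two_pow K n u)]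
        exact u.memBV.variation_cellAverage_le n
    _ ≤ (2 * d + 1) * (d * d * ‖u‖) := by
        gcongr
        exact u.variation_le_norm
    _ = (2 * d + 1) * (d * d) * ‖u‖ := by ring

theorem norm_haarBV_haarIndex_le (hk : k < 2 ^ (n * d)) {r : Fin (2 ^ d)} (hr : r ≠ 0) :
    ‖haarBV K (haarIndex d n k r)‖ ≤
      (2 * d + 1) * (haarScale d n * (2 ^ d * (2 * d * (((2 : ℝ) ^ (n + 1))⁻¹) ^ (d - 1)))) := by
  have hscale := haarScale_pos d n
  refine BV.norm_le_of_variation_le _ (by positivity) ?_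
  rw [variation_congr (coe_haarBV K _), haarSeq_haarIndex K hk hr]
  exact variation_haar_le K hk r

-- `haarScale²` times the volume `h ^ (d - 1) * h` of a cell of the next generation is `2⁻ᵈ`, so the
-- bound does not depend on the generation.
theorem exists_sum_generation_norm_le : ∃ C : ℝ, ∀ n (u : BV d),
    ∑ k ∈ Finset.range (2 ^ (n * d)), ∑ r ∈ Finset.univ.erase 0,
      |∫ x, u x * haar K n k r x| * ‖haarBV K (haarIndex d n k r)‖ ≤ C * ‖u‖ := by
  refine ⟨(2 * d + 1) * (2 * d * 2 ^ d * (d * d * 2 ^ d)), fun n u => ?_⟩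
  let h : ℝ := ((2 : ℝ) ^ (n + 1))⁻¹
  let M : ℝ := (2 * d + 1) * (haarScale d n * (2 ^ d * (2 * d * h ^ (d - 1))))
  let S : ℝ := haarScale d n * (2 ^ d * (d * (d * h) * (variation u).toReal))
  have hscale := haarScale_pos d n
  have hM : 0 ≤ M := by positivity
  have hS : 0 ≤ S := by positivity
  have hvolume : haarScale d n * haarScale d n * (h ^ (d - 1) * h) * 2 ^ d = 1 := by
    rw [← pow_succ, Nat.sub_add_cancel (NeZero.pos d)]
    exact haarScale_mul_self_mul_volume d n
  calc ∑ k ∈ Finset.range (2 ^ (n * d)), ∑ r ∈ Finset.univ.erase 0,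
        |∫ x, u x * haar K n k r x| * ‖haarBV K (haarIndex d n k r)‖
      ≤ ∑ k ∈ Finset.range (2 ^ (n * d)), ∑ r ∈ Finset.univ.erase 0,
          |∫ x, u x * haar K n k r x| * M :=
        Finset.sum_le_sum fun k hk => Finset.sum_le_sum fun r hr =>
          mul_le_mul_of_nonneg_left (norm_haarBV_haarIndex_le K (Finset.mem_range.1 hk)
            (Finset.ne_of_mem_erase hr)) (abs_nonneg _)
    _ = ∑ r ∈ Finset.univ.erase 0,
          (∑ k ∈ Finset.range (2 ^ (n * d)), |∫ x, u x * haar K n k r x|) * M := by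
        rw [Finset.sum_comm]
        simp only [Finset.sum_mul]
    _ ≤ ∑ _r ∈ Finset.univ.erase (0 : Fin (2 ^ d)), S * M :=
        Finset.sum_le_sum fun r hr => mul_le_mul_of_nonneg_right
          (sum_abs_integral_mul_haar_le K u.memBV n (Finset.ne_of_mem_erase hr)) hM
    _ ≤ ∑ _r : Fin (2 ^ d), S * M :=
        Finset.sum_le_sum_of_subset_of_nonneg (Finset.erase_subset _ _)
          fun _ _ _ => mul_nonneg hS hM
    _ = (2 * d + 1) * (2 * d * 2 ^ d * (d * d * 2 ^ d)) * (variation u).toReal := by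
        simp only [Finset.sum_const, Finset.card_univ, Fintype.card_fin, nsmul_eq_mul, S, M]
        push_cast
        linear_combination
          (2 * d + 1) * (2 * d * 2 ^ d * (d * d * 2 ^ d)) * (variation u).toReal * hvolume
    _ ≤ (2 * d + 1) * (2 * d * 2 ^ d * (d * d * 2 ^ d)) * ‖u‖ := by
        gcongr
        exact u.variation_le_norm

theorem norm_haarSum_sub_le {N : ℕ} (hle : 2 ^ (n * d) ≤ N) (hlt : N < 2 ^ ((n + 1) * d))
    (u : BV d) :
    ‖haarSum K N u - haarSum K (2 ^ (n * d)) u‖ ≤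
      ∑ k ∈ Finset.range (2 ^ (n * d)), ∑ r ∈ Finset.univ.erase 0,
        |∫ x, u x * haar K n k r x| * ‖haarBV K (haarIndex d n k r)‖ := by
  let g (j : ℕ) : BV d := (∫ x, u x * haarSeq K j x) • haarBV K j
  calc ‖haarSum K N u - haarSum K (2 ^ (n * d)) u‖
      = ‖∑ j ∈ Finset.Ico (2 ^ (n * d)) N, g j‖ := by
        rw [haarSum_apply, haarSum_apply, Finset.sum_Ico_eq_sub _ hle]
    _ ≤ ∑ j ∈ Finset.Ico (2 ^ (n * d)) (2 ^ ((n + 1) * d)), ‖g j‖ :=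
        (norm_sum_le _ _).trans <| Finset.sum_le_sum_of_subset_of_nonneg
          (Finset.Ico_subset_Ico_right hlt.le) fun _ _ _ => norm_nonneg _
    _ = ∑ k ∈ Finset.range (2 ^ (n * d)), ∑ r ∈ Finset.univ.erase 0, ‖g (haarIndex d n k r)‖ := by
        rw [Finset.sum_Ico_eq_sub _ (hle.trans hlt.le), sum_range_generation, add_sub_cancel_left]
    _ = _ := by
        refine Finset.sum_congr rfl fun k hk => Finset.sum_congr rfl fun r hr => ?_
        rw [norm_smul, Real.norm_eq_abs,
          haarSeq_haarIndex K (Finset.mem_range.1 hk) (Finset.ne_of_mem_erase hr)]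

theorem exists_norm_haarSum_le : ∃ C : ℝ, ∀ N, ‖haarSum K N‖ ≤ C := by
  obtain ⟨C, hC⟩ := exists_sum_generation_norm_le K
  let D : ℝ := (2 * d + 1) * (d * d) + max C 0
  have hD : 0 ≤ D := add_nonneg (by positivity) (le_max_right C 0)
  refine ⟨D, fun N => ContinuousLinearMap.opNorm_le_bound _ hD fun u => ?_⟩
  rcases eq_or_ne N 0 with rfl | hN
  · rw [haarSum_apply, Finset.sum_range_zero, norm_zero]
    positivity
  · obtain ⟨n, hle, hlt⟩ := exists_generation (d := d) hN
    calc ‖haarSum K N u‖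
        ≤ ‖haarSum K (2 ^ (n * d)) u‖ + ‖haarSum K N u - haarSum K (2 ^ (n * d)) u‖ :=
          norm_le_norm_add_norm_sub' _ _
      _ ≤ (2 * d + 1) * (d * d) * ‖u‖ + C * ‖u‖ :=
          add_le_add (ContinuousLinearMap.le_of_opNorm_le _ (norm_haarSum_two_pow_le K n) u)
            ((norm_haarSum_sub_le K hle hlt u).trans (hC n u))
      _ ≤ D * ‖u‖ := by
          rw [← add_mul]
          exact mul_le_mul_of_nonneg_right (by simp [D]) (norm_nonneg u)

end haarSum

section density

variable {d : ℕ} {g : Space d → ℝ} {n : ℕ} {x y : Space d} {ε : ℝ}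

theorem dist_le_of_cellIndex_eq (h : cellIndex n x = cellIndex n y) :
    dist x y ≤ d * ((2 : ℝ) ^ n)⁻¹ := by
  have hcoord (i : Fin d) : |(x - y) i| ≤ ((2 : ℝ) ^ n)⁻¹ := by
    have hfloor := Int.abs_sub_lt_one_of_floor_eq_floor (congrFun h i)
    rw [← mul_sub, abs_mul, abs_of_pos (by positivity)] at hfloor
    rw [← one_div, le_div_iff₀' (by positivity)]
    exact hfloor.le
  calc dist x y ≤ ∑ i, |(x - y) i| := (dist_eq_norm x y).trans_le (norm_le_sum_abs _)
    _ ≤ ∑ _i : Fin d, ((2 : ℝ) ^ n)⁻¹ := Finset.sum_le_sum fun i _ => hcoord i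
    _ = d * ((2 : ℝ) ^ n)⁻¹ := by simp

theorem abs_cellAverage_sub_le (hg : Integrable g)
    (h : ∀ y, cellIndex n y = cellIndex n x → |g y - g x| ≤ ε) :
    |cellAverage n g x - g x| ≤ ε := by
  have hvolume : 0 < volume.real (cell n (cellIndex n x)) := by
    rw [volume_real_cell]
    positivity
  obtain ⟨hpos, hfin⟩ := ENNReal.toReal_pos_iff.1 hvolume
  exact (convex_closedBall (g x) ε).set_average_mem Metric.isClosed_closedBall hpos.ne' hfin.ne
    (ae_restrict_of_forall_mem (measurableSet_cell _ _) h) hg.integrableOn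

theorem exists_abs_cellAverage_sub_le (hg : Continuous g) (hsupp : HasCompactSupport g)
    (hε : 0 < ε) : ∃ n, ∀ x, |cellAverage n g x - g x| ≤ ε := by
  obtain ⟨δ, hδ, hunif⟩ :=
    Metric.uniformContinuous_iff.1 (hsupp.uniformContinuous_of_continuous hg) ε hε
  have hlim : Tendsto (fun n : ℕ => d * ((2 : ℝ) ^ n)⁻¹) atTop (𝓝 0) := by
    simpa using (tendsto_inv_atTop_zero.comp
      (tendsto_pow_atTop_atTop_of_one_lt (one_lt_two (α := ℝ)))).const_mul (d : ℝ)
  obtain ⟨n, hn⟩ := (hlim.eventually_lt_const hδ).exists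
  exact ⟨n, fun x => abs_cellAverage_sub_le (hg.integrable_of_hasCompactSupport hsupp)
    fun y hy => (hunif ((dist_le_of_cellIndex_eq hy).trans_lt hn)).le⟩

theorem volume_unitCube (d : ℕ) : volume (unitCube d) = 1 := by
  rw [measure_congr (unitCube_ae_eq_cell d), ← ENNReal.toReal_eq_one_iff, ← measureReal_def,
    volume_real_cell]
  simp

variable [NeZero d] (K : DyadicNumbering d)

theorem coe_sum_smul_haarLp (s : Finset ℕ) (a : ℕ → ℝ) :
    (∑ j ∈ s, a j • haarLp K j : Lp ℝ d (cubeMeasure d)) =ᵐ[cubeMeasure d]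
      fun x => ∑ j ∈ s, a j * haarSeq K j x := by
  have hterm : ∀ᵐ x ∂cubeMeasure d, ∀ j, (a j • haarLp K j) x = a j * haarSeq K j x := by
    refine ae_all_iff.2 fun j => ?_
    filter_upwards [Lp.coeFn_smul (a j) (haarLp K j), (memLp_haarSeq K j).coeFn_toLp]
      with x hsmul hhaar
    rw [hsmul, Pi.smul_apply, smul_eq_mul, haarLp, hhaar]
  filter_upwards [Lp.coeFn_fun_finsetSum s fun j => a j • haarLp K j, hterm] with x hsum hx
  rw [hsum, Finset.sum_congr rfl fun j _ => hx j]

theorem exists_mem_span_haarLp_eLpNorm_sub_le (hg : Continuous g) (hsupp : HasCompactSupport g)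
    (hε : 0 < ε) :
    ∃ f ∈ Submodule.span ℝ (Set.range (haarLp K)),
      eLpNorm (g - ⇑f) d (cubeMeasure d) ≤ ENNReal.ofReal ε := by
  obtain ⟨n, hn⟩ := exists_abs_cellAverage_sub_le hg hsupp hε
  refine ⟨∑ j ∈ Finset.range (2 ^ (n * d)), (∫ y, g y * haarSeq K j y) • haarLp K j,
    Submodule.sum_mem _ fun j _ => Submodule.smul_mem _ _ (Submodule.subset_span ⟨j, rfl⟩), ?_⟩
  refine (eLpNorm_le_of_ae_bound (C := ε) ?_).trans (by simp [volume_unitCube])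
  filter_upwards [coe_sum_smul_haarLp K _ _,
    ae_restrict_of_ae (ae_sum_haarSeq_eq K (hg.integrable_of_hasCompactSupport hsupp) n),
    ae_restrict_of_ae (unitCube_ae_eq_cell d).mem_iff,
    ae_restrict_mem (isCompact_unitCube d).measurableSet] with x hsum haverage hcube hx
  rw [Pi.sub_apply, hsum, haverage (hcube.1 hx), norm_sub_rev]
  exact hn x

theorem topologicalClosure_span_haarLp :
    (Submodule.span ℝ (Set.range (haarLp K))).topologicalClosure = ⊤ := by
  refine Submodule.eq_top_iff'.2 fun f => Metric.mem_closure_iff.2 fun ε hε => ?_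
  obtain ⟨g, hsupp, hfg, hg, hgLp⟩ :=
    (Lp.memLp f).exists_hasCompactSupport_eLpNorm_sub_le (ENNReal.natCast_ne_top d)
      (ε := ENNReal.ofReal (ε / 3)) (by simpa using hε)
  obtain ⟨h, hspan, hgh⟩ :=
    exists_mem_span_haarLp_eLpNorm_sub_le K hg hsupp (show 0 < ε / 3 by positivity)
  refine ⟨h, hspan, ?_⟩
  have hfh : eLpNorm (⇑f - ⇑h) d (cubeMeasure d) ≤ ENNReal.ofReal (ε / 3 + ε / 3) := by
    rw [ENNReal.ofReal_add (by positivity) (by positivity), ← sub_add_sub_cancel _ g]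
    exact (eLpNorm_add_le ((Lp.aestronglyMeasurable f).sub hgLp.1)
      (hgLp.1.sub (Lp.aestronglyMeasurable h)) Fact.out).trans (add_le_add hfg hgh)
  rw [Lp.dist_def]
  exact (ENNReal.toReal_le_of_le_ofReal (by positivity) hfh).trans_lt (by linarith)

theorem SCH_le_closure_span : SCH d ≤
    (Submodule.span ℝ (Set.range fun j => T d (haarLp K j))).topologicalClosure := by
  refine Submodule.topologicalClosure_minimal _ ?_ (Submodule.isClosed_topologicalClosure _)
  rw [LinearMap.range_eq_map, ← topologicalClosure_span_haarLp K]
  refine (Submodule.topologicalClosure_map (T d) _).trans_eq ?_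
  rw [Submodule.map_span, ← Set.range_comp]
  rfl

end density

section basis

theorem equicontinuous_comp_of_norm_le {ι 𝕜 E F G : Type*} [NontriviallyNormedField 𝕜]
    [SeminormedAddCommGroup E] [NormedSpace 𝕜 E] [SeminormedAddCommGroup F] [NormedSpace 𝕜 F]
    [SeminormedAddCommGroup G] [NormedSpace 𝕜 G] {L : ι → E →L[𝕜] F} {C : ℝ}
    (hL : ∀ i, ‖L i‖ ≤ C) : Equicontinuous fun i (α : F →L[𝕜] G) => α ∘L L i := by
  refine (LipschitzWith.uniformEquicontinuous _ C.toNNReal fun i =>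
    LipschitzWith.of_dist_le_mul fun α β => ?_).equicontinuous
  rw [dist_eq_norm, dist_eq_norm, ← ContinuousLinearMap.sub_comp, mul_comm]
  exact ((α - β).opNorm_comp_le (L i)).trans
    (mul_le_mul_of_nonneg_left ((hL i).trans (Real.le_coe_toNNReal C)) (norm_nonneg _))

variable {d : ℕ} [NeZero d] (K : DyadicNumbering d)

theorem T_haarLp_haarBV (i j : ℕ) : T d (haarLp K i) (haarBV K j) = if i = j then 1 else 0 := by
  rw [T_haarLp_apply, ← integral_haarSeq_mul K i j]
  refine integral_congr_ae ?_
  filter_upwards [coe_haarBV K j] with x hx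
  rw [hx, mul_comm]

theorem comp_haarSum (α : StrongDual ℝ (BV d)) (N : ℕ) :
    α ∘L haarSum K N = ∑ j ∈ Finset.range N, α (haarBV K j) • T d (haarLp K j) := by
  ext u
  simp [haarSum, mul_comm]

theorem eventually_comp_haarSum_eq {β : StrongDual ℝ (BV d)}
    (hβ : β ∈ Submodule.span ℝ (Set.range fun j => T d (haarLp K j))) :
    ∀ᶠ N in atTop, β ∘L haarSum K N = β := by
  induction hβ using Submodule.span_induction with
  | mem β hβ =>
    obtain ⟨j, rfl⟩ := hβ
    filter_upwards [eventually_gt_atTop j] with N hN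
    simp [comp_haarSum, T_haarLp_haarBV, hN]
  | zero => simp
  | add β γ _ _ hβ hγ =>
    filter_upwards [hβ, hγ] with N hβN hγN
    rw [ContinuousLinearMap.add_comp, hβN, hγN]
  | smul c β _ hβ =>
    filter_upwards [hβ] with N hβN
    rw [ContinuousLinearMap.smul_comp, hβN]

theorem tendsto_sum_smul_T_haarLp {α : StrongDual ℝ (BV d)} (hα : α ∈ SCH d) :
    Tendsto (fun N => ∑ j ∈ Finset.range N, α (haarBV K j) • T d (haarLp K j)) atTop (𝓝 α) := by
  simp only [← comp_haarSum]
  obtain ⟨C, hC⟩ := exists_norm_haarSum_le K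
  exact (equicontinuous_comp_of_norm_le hC α).tendsto_of_mem_closure continuousWithinAt_id
    (fun _ hβ => tendsto_nhds_of_eventually_eq (eventually_comp_haarSum_eq K hβ))
    (SCH_le_closure_span K hα)

/-- Evaluation at the `j`-th Haar function, as a functional on `SCH([0, 1]ᵈ)`. -/
noncomputable def haarCoord (j : ℕ) : StrongDual ℝ (SCH d) :=
  ContinuousLinearMap.apply ℝ ℝ (haarBV K j) ∘L (SCH d).subtypeL

theorem haarCoord_haarCharge (i j : ℕ) :
    haarCoord K i (haarCharge K j) = if j = i then 1 else 0 :=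
  T_haarLp_haarBV K j i

theorem tendsto_sum_haarCoord (α : SCH d) :
    Tendsto (fun N => ∑ j ∈ Finset.range N, haarCoord K j α • haarCharge K j) atTop (𝓝 α) := by
  rw [tendsto_subtype_rng]
  refine (tendsto_sum_smul_T_haarLp K α.2).congr fun N => ?_
  simp only [Submodule.coe_sum, Submodule.coe_smul]
  rfl

theorem eq_haarCoord_of_tendsto {α : SCH d} {a : ℕ → ℝ}
    (h : Tendsto (fun N => ∑ j ∈ Finset.range N, a j • haarCharge K j) atTop (𝓝 α)) (i : ℕ) :
    a i = haarCoord K i α := by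
  refine tendsto_nhds_unique (tendsto_const_nhds.congr' ?_)
    (((haarCoord K i).continuous.tendsto α).comp h)
  filter_upwards [eventually_gt_atTop i] with N hN
  simp [haarCoord_haarCharge, hN]

/-- The Schauder basis of `SCH([0, 1]ᵈ)` given by the Haar functions. -/
noncomputable def haarBasis : SchauderBasis ℝ (SCH d) where
  basis := haarCharge K
  coord := haarCoord K
  ortho i j := by simp [haarCoord_haarCharge, Pi.single_apply, eq_comm]
  expansion α := by
    rw [HasSum, SummationFilter.conditional_filter_eq_map_range, tendsto_map'_iff]
    exact tendsto_sum_haarCoord K α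

end basis

end StrongCharge

theorem mainTheorem4 (d : ℕ) [NeZero d] (K : DyadicNumbering d) :
    -- the sequence `T_g` is a Schauder basis of `SCH([0, 1]ᵈ)`
    (∀ α : SCH d, ∃! a : ℕ → ℝ,
      Tendsto (fun N => ∑ j ∈ Finset.range N, a j • haarCharge K j) atTop (𝓝 α)) ∧
    -- the decomposition of a strong charge functional, in the norm of `BV([0, 1]ᵈ)^*`
    (∀ α : SCH d,
      Tendsto (fun N => ∑ j ∈ Finset.range N,
        (α : StrongDual ℝ (BV d)) (haarBV K j) • T d (haarLp K j)) atTop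
        (𝓝 (α : StrongDual ℝ (BV d)))) ∧
    -- the same, in terms of Mathlib's bundled Schauder bases
    ∃ b : SchauderBasis ℝ (SCH d),
      (∀ j, b j = haarCharge K j) ∧
      ∀ j (α : SCH d), b.coord j α = (α : StrongDual ℝ (BV d)) (haarBV K j) :=
  ⟨fun α => ⟨fun j => haarCoord K j α, tendsto_sum_haarCoord K α,
      fun _ ha => funext fun i => eq_haarCoord_of_tendsto K ha i⟩,
    fun α => tendsto_sum_smul_T_haarLp K α.2,
    haarBasis K, fun _ => rfl, fun _ _ => rfl⟩
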